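/- Let $\mathsf{CRING}$ be the category of commutative unital rings. For a commutative ring $R$ let $\mathsf T(R)=\mathrm{Sym}_R(\Omega_{R/\mathbb Z})$, the commutative $R$-algebra generated by symbols $\mathsf d(a)$, $a\in R$, subject to $\mathsf d(1)=0$, $\mathsf d(a+b)=\mathsf d(a)+\mathsf d(b)$, $\mathsf d(ab)=a\,\mathsf d(b)+b\,\mathsf d(a)$; for a ring morphism $f$ put $\mathsf T(f)(a)=f(a)$, $\mathsf T(f)(\mathsf d(a))=\mathsf d(f(a))$. Equip $\mathsf{CRING}^{op}$ with the tangent structure $\mathbb T$ whose functor is $\mathsf T$ and whose projection $\mathsf p$, sum $+$, zero $0$ and vertical lift $\ell$ are, as ring morphisms, $\mathsf p_R:R\to\mathsf T(R)$, $a\mapsto a$; $+_R:\mathsf T(R)\to\mathsf T(R)\otimes_R\mathsf T(R)$, $a\mapsto a\otimes 1$, $\mathsf d(a)\mapsto \mathsf d(a)\otimes1+1\otimes\mathsf d(a)$; $0_R:\mathsf T(R)\to R$, $a\mapsto a$, $\mathsf d(a)\mapsto0$; and $\ell_R:\mathsf T(\mathsf T(R))\to\mathsf T(R)$, $a\mapsto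 a$, $\mathsf d(a)\mapsto 0$, $\mathsf d'(a)\mapsto0$, $\mathsf d'\mathsf d(a)\mapsto\mathsf d(a)$, where $\mathsf d'$ is the outer differential. (The canonical flip $\mathsf d(a)\leftrightarrow\mathsf d'(a)$ and the negative $\mathsf d(a)\mapsto-\mathsf d(a)$ of $\mathbb T$ do not enter below.) A differential bundle over $R$ in $(\mathsf{CRING}^{op},\mathbb T)$ is a quadruple of maps of $\mathsf{CRING}^{op}$, $\mathsf q:E\to R$, $\sigma:E_2\to E$, $\mathsf z:R\to E$, $\lambda:E\to\mathsf T(E)$, where $E_n$, with projections $\pi_j:E_n\to E$, is the pullback of $n$ copies of $\mathsf q$, such that: all $\mathsf T^m$ preserve the pullbacks $E_n$; $(\mathsf q,\sigma,\mathsf z)$ is a commutative monoid over $R$; $\lambda$ is a morphism of additive bundles from $(\mathsf q,\sigma,\mathsf z)$ to $(\mathsf T(\mathsf q),\mathsf T(\sigma),\mathsf T(\mathsf z))$ over $0_R$, and to $(\mathsf p_E,+_E,0_E)$ over $\mathsf z$; $\mathsf T(\lambda)\circ\lambda=\ell_E\circ\lambda$; and the square with sides $\mu=\mathsf T(\sigma)\circ\langle\lambda\circ\pi_1,0_E\circ\pi_2\rangle:E_2\to\mathsf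 T(E)$, $\mathsf q\circ\pi_1:E_2\to R$, $\mathsf T(\mathsf q)$ and $0_R:R\to\mathsf T(R)$ is a pullback preserved by all $\mathsf T^m$. A negative for it is a map $\iota:E\to E$ over $R$ which makes $(\mathsf q,\sigma,\mathsf z)$ an Abelian group over $R$; a differential bundle with negatives is a differential bundle together with a negative. A morphism of differential bundles over $R$ (with or without negatives) is a map $f:E\to E'$ of $\mathsf{CRING}^{op}$ with $\mathsf q'\circ f=\mathsf q$ and $\lambda'\circ f=\mathsf T(f)\circ\lambda$. For an $R$-module $M$, let $\mathsf M_R(M)$ be $\mathrm{Sym}_R(M)$ with the structure given on generators $a\in R$, $m\in M$ by the ring morphisms $\mathsf q_M(a)=a$; $\sigma_M(a)=a\otimes1$, $\sigma_M(m)=m\otimes1+1\otimes m$; $\mathsf z_M(a)=a$, $\mathsf z_M(m)=0$; $\lambda_M(a)=a$, $\lambda_M(m)=0$, $\lambda_M(\mathsf d(a))=0$, $\lambda_M(\mathsf d(m))=m$; $\iota_M(a)=a$, $\iota_M(m)=-m$. For a differential bundle $\mathcal E$ over $R$, let $\mathsf D_\lambda:E\to E$, $\mathsf D_\lambda(x)=\lambda(\mathsf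 d(x))$, where $\lambda:\mathsf T(E)\to E$ is read as a ring morphism; it is $R$-linear for the $R$-module structure of $E$ given by $\mathsf q:R\to E$, so that $\mathrm{im}(\mathsf D_\lambda)$ is an $R$-module. **Proposition.** Let $R$ be a commutative ring. 1. For every $R$-module $M$, $\mathsf M_R(M)$ is a differential bundle with negatives over $R$, and $m\mapsto m$ is an isomorphism of $R$-modules $M\cong\mathrm{im}(\mathsf D_{\lambda_M})$. 2. For every differential bundle $\mathcal E$ over $R$ (with or without negatives), the $R$-algebra morphism $\mathrm{Sym}_R(\mathrm{im}(\mathsf D_\lambda))\to E$ that extends the inclusion is an isomorphism of differential bundles over $R$ between $\mathcal E$ and $\mathsf M_R(\mathrm{im}(\mathsf D_\lambda))$. 3. Every differential bundle over $R$ has exactly one negative. 4. Consequently $M\mapsto\mathsf M_R(M)$ and $\mathcal E\mapsto\mathrm{im}(\mathsf D_\lambda)$ are well defined on isomorphism classes and are mutually inverse bijections between isomorphism classes of $R$-modules and isomorphism classes of differential bundles over $R$ in $(\mathsf{CRING}^{op},\mathbb T)$, and likewise for differential bundles with negatives over $R$. -/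

import Mathlib

open CategoryTheory CategoryTheory.Limits Opposite
open scoped KaehlerDifferential

universe u

noncomputable section

namespace AffTangent

/-! ## The ring `T(R) = Sym_R (Ω(R))` -/

section TangentRing

variable {R S B : Type u} [CommRing R] [CommRing S] [CommRing B]

/-- The tangent ring `T(R)`: the free symmetric `R`-algebra on the module of (absolute) Kähler
differentials of `R`. -/
abbrev TRing (R : Type u) [CommRing R] : Type u := SymmetricAlgebra R (Ω[R⁄ℤ])

/-- The inclusion `R → T(R)`, `a ↦ a`. -/
abbrev TRing.incl (R : Type u) [CommRing R] : R →+* TRing R := algebraMap R (TRing R)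

/-- The generator `d(a)` of `T(R)`; it is additive in `a`. -/
def TRing.d (R : Type u) [CommRing R] : R →+ TRing R where
  toFun a := SymmetricAlgebra.ι R (Ω[R⁄ℤ]) (KaehlerDifferential.D ℤ R a)
  map_zero' := by simp
  map_add' a b := by simp

theorem TRing.d_mul (a b : R) :
    TRing.d R (a * b) = TRing.incl R a * TRing.d R b + TRing.incl R b * TRing.d R a := by
  simp [TRing.d, Algebra.smul_def]

/-- The ring morphism `T(R) → B` given on generators by `a ↦ g a`, `d(a) ↦ D a`, where `D` is a
derivation along `g`. -/
def TRing.lift (g : R →+* B) (D : R →+ B)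
    (hD : ∀ a b, D (a * b) = g a * D b + g b * D a) : TRing R →+* B :=
  letI : Algebra R B := g.toAlgebra
  (SymmetricAlgebra.lift
    (Derivation.mk' D.toIntLinearMap hD : Derivation ℤ R B).liftKaehlerDifferential).toRingHom

@[simp]
theorem TRing.lift_incl (g : R →+* B) (D : R →+ B)
    (hD : ∀ a b, D (a * b) = g a * D b + g b * D a) (a : R) :
    TRing.lift g D hD (algebraMap R (TRing R) a) = g a := by
  let _ : Algebra R B := g.toAlgebra
  exact (SymmetricAlgebra.lift (Derivation.mk' D.toIntLinearMap hD :
    Derivation ℤ R B).liftKaehlerDifferential).commutes a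

@[simp]
theorem TRing.lift_d (g : R →+* B) (D : R →+ B)
    (hD : ∀ a b, D (a * b) = g a * D b + g b * D a) (a : R) :
    TRing.lift g D hD (TRing.d R a) = D a := by
  let _ : Algebra R B := g.toAlgebra
  have h := SymmetricAlgebra.lift_ι_apply (Derivation.mk' D.toIntLinearMap hD :
    Derivation ℤ R B).liftKaehlerDifferential (KaehlerDifferential.D ℤ R a)
  rw [Derivation.liftKaehlerDifferential_comp_D] at h
  exact h

/-- Ring morphisms out of `T(R)` are determined by their values on the generators. -/
theorem TRing.hom_ext {f g : TRing R →+* B}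
    (h₀ : ∀ a, f (algebraMap R (TRing R) a) = g (algebraMap R (TRing R) a))
    (h₁ : ∀ a, f (TRing.d R a) = g (TRing.d R a)) : f = g := by
  let _ : Algebra R B := (f.comp (algebraMap R (TRing R))).toAlgebra
  let f' : TRing R →ₐ[R] B := { f with commutes' := fun _ => rfl }
  let g' : TRing R →ₐ[R] B := { g with commutes' := fun a => (h₀ a).symm }
  have key : f' = g' := by
    apply SymmetricAlgebra.algHom_ext
    apply Derivation.liftKaehlerDifferential_unique
    ext a
    exact h₁ a
  ext x
  exact congrArg (fun k : TRing R →ₐ[R] B => k x) key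

/-- `T(f)`: `a ↦ f a`, `d(a) ↦ d(f a)`. -/
def TRing.map (f : R →+* S) : TRing R →+* TRing S :=
  TRing.lift ((TRing.incl S).comp f) ((TRing.d S).comp f.toAddMonoidHom)
    (fun a b => by simpa using TRing.d_mul (f a) (f b))

/-- The ring morphism `f^♯ : T(R) → B` attached to a ring morphism `f : R → B[ε]`,
`f a = f₁ a + f₂ a ε`; it is given by `a ↦ f₁ a`, `d(a) ↦ f₂ a`. -/
def TRing.sharp (f : R →+* DualNumber B) : TRing R →+* B :=
  TRing.lift ((TrivSqZeroExt.fstHom B B B).toRingHom.comp f)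
    ((TrivSqZeroExt.sndHom B B).toAddMonoidHom.comp f.toAddMonoidHom)
    (fun a b => by simp [mul_comm])

/-- The zero `0_R : T(R) → R`: `a ↦ a`, `d(a) ↦ 0`. -/
def TRing.zero (R : Type u) [CommRing R] : TRing R →+* R :=
  TRing.lift (RingHom.id R) 0 (by simp)

/-- The ring morphism `T(R) → T(R)[ε]`, `a ↦ a`, `d(a) ↦ d(a) ε`. -/
def TRing.scaleEps (R : Type u) [CommRing R] : TRing R →+* DualNumber (TRing R) :=
  TRing.lift ((TrivSqZeroExt.inlHom (TRing R) (TRing R)).comp (TRing.incl R))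
    ((TrivSqZeroExt.inrHom (TRing R) (TRing R)).toAddMonoidHom.comp (TRing.d R))
    (fun a b => by
      simp only [AddMonoidHom.coe_comp, Function.comp_apply, TRing.d_mul, map_add]
      congr 1 <;> ext <;> simp [mul_comm])

/-- The vertical lift `ℓ_R : T(T(R)) → T(R)`.  With `d'` the outer differential,
`a ↦ a`, `d(a) ↦ 0`, `d'(a) ↦ 0`, `d'(d(a)) ↦ d(a)`. -/
def TRing.vlift (R : Type u) [CommRing R] : TRing (TRing R) →+* TRing R :=
  TRing.sharp (TRing.scaleEps R)

theorem TRing.vlift_incl_incl (a : R) :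
    TRing.vlift R (TRing.incl _ (TRing.incl R a)) = TRing.incl R a := by
  simp [TRing.vlift, TRing.sharp, TRing.scaleEps]

theorem TRing.vlift_incl_d (a : R) : TRing.vlift R (TRing.incl _ (TRing.d R a)) = 0 := by
  simp [TRing.vlift, TRing.sharp, TRing.scaleEps]

theorem TRing.vlift_d_incl (a : R) : TRing.vlift R (TRing.d _ (TRing.incl R a)) = 0 := by
  simp [TRing.vlift, TRing.sharp, TRing.scaleEps]

theorem TRing.vlift_d_d (a : R) :
    TRing.vlift R (TRing.d _ (TRing.d R a)) = TRing.d R a := by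
  simp [TRing.vlift, TRing.sharp, TRing.scaleEps]

theorem TRing.map_id : TRing.map (RingHom.id R) = RingHom.id (TRing R) :=
  TRing.hom_ext (by simp [TRing.map]) (by simp [TRing.map])

theorem TRing.map_comp (f : R →+* S) (g : S →+* B) :
    TRing.map (g.comp f) = (TRing.map g).comp (TRing.map f) :=
  TRing.hom_ext (by simp [TRing.map]) (by simp [TRing.map])

theorem TRing.zero_comp_map (f : R →+* S) :
    (TRing.zero S).comp (TRing.map f) = f.comp (TRing.zero R) :=
  TRing.hom_ext (by simp [TRing.map, TRing.zero]) (by simp [TRing.map, TRing.zero])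

/-- For ring morphisms `u, v : T(R) → B` that agree on `R`, the ring morphism `T(R) → B` with
`a ↦ u(a) = v(a)`, `d(a) ↦ u(d(a)) + v(d(a))`. -/
def TRing.add (u v : TRing R →+* B) (h : u.comp (TRing.incl R) = v.comp (TRing.incl R)) :
    TRing R →+* B :=
  TRing.lift (u.comp (TRing.incl R))
    (u.toAddMonoidHom.comp (TRing.d R) + v.toAddMonoidHom.comp (TRing.d R))
    (fun a b => by
      have h' : ∀ c, v (algebraMap R (TRing R) c) = u (algebraMap R (TRing R) c) :=
        fun c => (congrArg (fun k : R →+* B => k c) h).symm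
      simp only [AddMonoidHom.add_apply, AddMonoidHom.coe_comp, Function.comp_apply,
        RingHom.toAddMonoidHom_eq_coe, AddMonoidHom.coe_coe, TRing.d_mul, map_add, map_mul,
        RingHom.comp_apply, h']
      ring)

theorem TRing.lift_d_smul (q : R →+* S) (lam : TRing S →+* S)
    (h : lam.comp (TRing.map q) = q.comp (TRing.zero R)) (a : R) (x : S) :
    lam (TRing.d S (q a * x)) = q a * lam (TRing.d S x) := by
  have h₀ : lam (algebraMap S (TRing S) (q a)) = q a := by
    simpa [TRing.map, TRing.zero] using RingHom.congr_fun h (algebraMap R (TRing R) a)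
  have h₁ : lam (TRing.d S (q a)) = 0 := by
    simpa [TRing.map, TRing.zero] using RingHom.congr_fun h (TRing.d R a)
  rw [TRing.d_mul, map_add, map_mul, map_mul, h₀, h₁, mul_zero, add_zero]

end TangentRing

/-! ## The tangent structure on affine schemes -/

/-- The category `CRING^op` of affine schemes. -/
abbrev Aff : Type (u + 1) := CommRingCat.{u}ᵒᵖ

/-- The tangent bundle functor `T` on `CRING^op`. -/
def T : Aff.{u} ⥤ Aff.{u} where
  obj X := op (CommRingCat.of (TRing X.unop))
  map f := (CommRingCat.ofHom (TRing.map f.unop.hom)).op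
  map_id X := by
    apply Quiver.Hom.unop_inj
    ext1
    exact TRing.map_id
  map_comp f g := by
    apply Quiver.Hom.unop_inj
    ext1
    exact TRing.map_comp g.unop.hom f.unop.hom

/-- The iterates `T^m`. -/
def Tpow : ℕ → (Aff.{u} ⥤ Aff.{u})
  | 0 => 𝟭 _
  | m + 1 => Tpow m ⋙ T

/-- The projection `p_X : T(X) → X`. -/
def p (X : Aff.{u}) : T.obj X ⟶ X := (CommRingCat.ofHom (TRing.incl X.unop)).op

/-- The zero `0_X : X → T(X)`. -/
def zero (X : Aff.{u}) : X ⟶ T.obj X := (CommRingCat.ofHom (TRing.zero X.unop)).op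

/-- The vertical lift `ℓ_X : T(X) → T(T(X))`. -/
def vlift (X : Aff.{u}) : T.obj X ⟶ T.obj (T.obj X) := (CommRingCat.ofHom (TRing.vlift X.unop)).op

theorem zero_naturality {X Y : Aff.{u}} (f : X ⟶ Y) : zero X ≫ T.map f = f ≫ zero Y := by
  apply Quiver.Hom.unop_inj
  ext1
  exact TRing.zero_comp_map f.unop.hom

/-! ### Pullbacks of `n` copies of a map -/

section Fib

variable {X E A : Aff.{u}} (q : E ⟶ A)

/-- The pullback `E_n` over `A` of `n` copies of `q : E → A` (so `E_0 = A`). It exists because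
`CRING` has all pushouts. -/
abbrev Fib (n : ℕ) : Aff.{u} := widePullback A (fun _ : Fin n => E) (fun _ => q)

/-- The projections `π_j : E_n → E`. -/
abbrev prj (n : ℕ) (j : Fin n) : Fib q n ⟶ E := WidePullback.π (fun _ => q) j

theorem prj_eq (n : ℕ) (i j : Fin n) : prj q n i ≫ q = prj q n j ≫ q := by
  rw [WidePullback.π_arrow, WidePullback.π_arrow]

variable {q}

/-- The pairing `⟨f, g⟩ : X → E_2`. -/
def fibPair (f g : X ⟶ E) (h : f ≫ q = g ≫ q) : X ⟶ Fib q 2 :=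
  WidePullback.lift (f ≫ q) ![f, g] (by
    intro j
    fin_cases j
    · rfl
    · exact h.symm)

/-- The pairing `⟨f, g⟩ : X → T(E_2)`, where `T(E_2)`, with projections `T(π_1)`, `T(π_2)`, is a
pullback of two copies of `T(q)` because `T` preserves the pullback `E_2`. -/
def tanPair (hT : PreservesLimit (WidePullbackShape.wideCospan A (fun _ : Fin 2 => E) fun _ => q) T)
    (f g : X ⟶ T.obj E) (h : f ≫ T.map q = g ≫ T.map q) : X ⟶ T.obj (Fib q 2) :=
  (isLimitOfPreserves T (limit.isLimit (WidePullbackShape.wideCospan A (fun _ : Fin 2 => E)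
    fun _ => q))).lift
    (WidePullbackShape.mkCone (F := WidePullbackShape.wideCospan A (fun _ : Fin 2 => E)
      (fun _ => q) ⋙ T) (f ≫ T.map q) ![f, g] (by
        intro j
        fin_cases j
        · rfl
        · exact h.symm))

theorem fibPair_fst (f g : X ⟶ E) (h : f ≫ q = g ≫ q) : fibPair f g h ≫ prj q 2 0 = f :=
  WidePullback.lift_π _ _ _ _ _

theorem fibPair_snd (f g : X ⟶ E) (h : f ≫ q = g ≫ q) : fibPair f g h ≫ prj q 2 1 = g :=
  WidePullback.lift_π _ _ _ _ _

theorem tanPair_fst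
    (hT : PreservesLimit (WidePullbackShape.wideCospan A (fun _ : Fin 2 => E) fun _ => q) T)
    (f g : X ⟶ T.obj E) (h : f ≫ T.map q = g ≫ T.map q) :
    tanPair hT f g h ≫ T.map (prj q 2 0) = f :=
  (isLimitOfPreserves T (limit.isLimit (WidePullbackShape.wideCospan A (fun _ : Fin 2 => E)
    fun _ => q))).fac _ (some 0)

theorem tanPair_snd
    (hT : PreservesLimit (WidePullbackShape.wideCospan A (fun _ : Fin 2 => E) fun _ => q) T)
    (f g : X ⟶ T.obj E) (h : f ≫ T.map q = g ≫ T.map q) :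
    tanPair hT f g h ≫ T.map (prj q 2 1) = g :=
  (isLimitOfPreserves T (limit.isLimit (WidePullbackShape.wideCospan A (fun _ : Fin 2 => E)
    fun _ => q))).fac _ (some 1)

end Fib

/-- The sum `+_X : T_2(X) → T(X)`; in `CRING` it is `a ↦ π_1(a) = π_2(a)`,
`d(a) ↦ π_1(d(a)) + π_2(d(a))` (that is, `d(a) ⊗ 1 + 1 ⊗ d(a)`). -/
def plus (X : Aff.{u}) : Fib (p X) 2 ⟶ T.obj X :=
  (CommRingCat.ofHom (TRing.add (R := X.unop) (prj (p X) 2 0).unop.hom (prj (p X) 2 1).unop.hom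
    (congrArg (fun k : Fib (p X) 2 ⟶ X => k.unop.hom) (prj_eq (p X) 2 0 1)))).op

/-! ## Differential bundles -/

/-- The data `(q : E → R, σ : E_2 → E, z : R → E, λ : E → T(E))` of a differential bundle over `R`
in `CRING^op`. -/
structure DBunData (R : CommRingCat.{u}) where
  /-- the total space -/
  E : Aff.{u}
  /-- the projection -/
  q : E ⟶ op R
  /-- the sum -/
  σ : Fib q 2 ⟶ E
  /-- the zero -/
  z : op R ⟶ E
  /-- the lift -/
  lam : E ⟶ T.obj E

/-- The axioms of a differential bundle. -/
structure DBunData.IsDifferentialBundle {R : CommRingCat.{u}} (𝓔 : DBunData R) : Prop where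
  /-- All `T^m` preserve the pullbacks of `n` copies of `q`. -/
  preserves : ∀ m n : ℕ, PreservesLimit
    (WidePullbackShape.wideCospan (op R) (fun _ : Fin n => 𝓔.E) fun _ => 𝓔.q) (Tpow m)
  -- `(q, σ, z)` is an additive bundle
  sum_proj : ∀ j : Fin 2, 𝓔.σ ≫ 𝓔.q = prj 𝓔.q 2 j ≫ 𝓔.q
  zero_proj : 𝓔.z ≫ 𝓔.q = 𝟙 (op R)
  sum_assoc :
    fibPair (fibPair (prj 𝓔.q 3 0) (prj 𝓔.q 3 1) (prj_eq 𝓔.q 3 0 1) ≫ 𝓔.σ) (prj 𝓔.q 3 2)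
        (by rw [Category.assoc, sum_proj 0, ← Category.assoc, fibPair_fst, prj_eq 𝓔.q 3 0 2]) ≫ 𝓔.σ =
      fibPair (prj 𝓔.q 3 0) (fibPair (prj 𝓔.q 3 1) (prj 𝓔.q 3 2) (prj_eq 𝓔.q 3 1 2) ≫ 𝓔.σ)
        (by rw [Category.assoc, sum_proj 0, ← Category.assoc, fibPair_fst, prj_eq 𝓔.q 3 0 1]) ≫ 𝓔.σ
  zero_sum : fibPair (𝓔.q ≫ 𝓔.z) (𝟙 𝓔.E) (by simp [zero_proj]) ≫ 𝓔.σ = 𝟙 𝓔.E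
  sum_zero : fibPair (𝟙 𝓔.E) (𝓔.q ≫ 𝓔.z) (by simp [zero_proj]) ≫ 𝓔.σ = 𝟙 𝓔.E
  sum_comm : fibPair (prj 𝓔.q 2 1) (prj 𝓔.q 2 0) (prj_eq 𝓔.q 2 1 0) ≫ 𝓔.σ = 𝓔.σ
  -- `λ` is additive over `0_R`
  lift_proj : 𝓔.lam ≫ T.map 𝓔.q = 𝓔.q ≫ zero (op R)
  lift_sum :
    𝓔.σ ≫ 𝓔.lam =
      tanPair (preserves 1 2) (prj 𝓔.q 2 0 ≫ 𝓔.lam) (prj 𝓔.q 2 1 ≫ 𝓔.lam)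
        (by rw [Category.assoc, Category.assoc, lift_proj, ← Category.assoc, ← Category.assoc,
          prj_eq 𝓔.q 2 0 1]) ≫ T.map 𝓔.σ
  lift_zero : 𝓔.z ≫ 𝓔.lam = zero (op R) ≫ T.map 𝓔.z
  -- `λ` is additive over `z`
  lift_p : 𝓔.lam ≫ p 𝓔.E = 𝓔.q ≫ 𝓔.z
  lift_plus :
    𝓔.σ ≫ 𝓔.lam =
      fibPair (q := p 𝓔.E) (prj 𝓔.q 2 0 ≫ 𝓔.lam) (prj 𝓔.q 2 1 ≫ 𝓔.lam)
        (by rw [Category.assoc, Category.assoc, lift_p, ← Category.assoc, ← Category.assoc,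
          prj_eq 𝓔.q 2 0 1]) ≫ plus 𝓔.E
  zero_lift : 𝓔.z ≫ 𝓔.lam = 𝓔.z ≫ zero 𝓔.E
  -- compatibility of `λ` with the vertical lift
  lift_lift : 𝓔.lam ≫ T.map 𝓔.lam = 𝓔.lam ≫ vlift 𝓔.E
  -- the square on `μ = ⟨λ ∘ π_1, 0_E ∘ π_2⟩ ≫ T(σ)` is a pullback, preserved by all `T^m`
  universal : ∀ m : ℕ, IsPullback
    ((Tpow m).map (tanPair (preserves 1 2) (prj 𝓔.q 2 0 ≫ 𝓔.lam) (prj 𝓔.q 2 1 ≫ zero 𝓔.E)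
      (by rw [Category.assoc, Category.assoc, lift_proj, zero_naturality, ← Category.assoc,
        ← Category.assoc, prj_eq 𝓔.q 2 0 1]) ≫ T.map 𝓔.σ))
    ((Tpow m).map (prj 𝓔.q 2 0 ≫ 𝓔.q))
    ((Tpow m).map (T.map 𝓔.q))
    ((Tpow m).map (zero (op R)))

/-- `ι : E → E` makes the additive bundle `(q, σ, z)` an Abelian group bundle. -/
structure DBunData.IsNegative {R : CommRingCat.{u}} (𝓔 : DBunData R) (ι : 𝓔.E ⟶ 𝓔.E) : Prop where
  neg_proj : ι ≫ 𝓔.q = 𝓔.q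
  sum_neg : fibPair (𝟙 𝓔.E) ι (by simp [neg_proj]) ≫ 𝓔.σ = 𝓔.q ≫ 𝓔.z
  neg_sum : fibPair ι (𝟙 𝓔.E) (by simp [neg_proj]) ≫ 𝓔.σ = 𝓔.q ≫ 𝓔.z

/-- Differential bundles over `R` in `CRING^op`. -/
structure DBun (R : CommRingCat.{u}) extends DBunData R where
  isDifferentialBundle : toDBunData.IsDifferentialBundle

/-- Differential bundles with negatives over `R` in `CRING^op`. -/
structure DBunNeg (R : CommRingCat.{u}) extends DBun R where
  /-- the negative -/
  ι : E ⟶ E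
  isNegative : toDBunData.IsNegative ι

/-- Morphisms of differential bundles over `R`: they preserve the projection and the lift. -/
@[ext]
structure DBun.Hom {R : CommRingCat.{u}} (𝓔 𝓕 : DBun R) where
  /-- the map of total spaces -/
  hom : 𝓔.E ⟶ 𝓕.E
  proj : hom ≫ 𝓕.q = 𝓔.q
  lift : 𝓔.lam ≫ T.map hom = hom ≫ 𝓕.lam

instance (R : CommRingCat.{u}) : Category (DBun R) where
  Hom := DBun.Hom
  id 𝓔 := ⟨𝟙 _, by simp, by simp⟩
  comp f g := ⟨f.hom ≫ g.hom, by simp [f.proj, g.proj], by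
    rw [T.map_comp, ← Category.assoc, f.lift, Category.assoc, g.lift, Category.assoc]⟩
  id_comp f := DBun.Hom.ext (Category.id_comp _)
  comp_id f := DBun.Hom.ext (Category.comp_id _)
  assoc f g h := DBun.Hom.ext (Category.assoc _ _ _)

/-- Morphisms of differential bundles with negatives are those of the underlying differential
bundles. -/
instance (R : CommRingCat.{u}) : Category (DBunNeg R) where
  Hom 𝓔 𝓕 := DBun.Hom 𝓔.toDBun 𝓕.toDBun
  id 𝓔 := 𝟙 𝓔.toDBun
  comp {𝓔 𝓕 𝓖} f g := CategoryStruct.comp (X := 𝓔.toDBun) (Y := 𝓕.toDBun) (Z := 𝓖.toDBun) f g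
  id_comp {𝓔 𝓕} f := Category.id_comp (X := 𝓔.toDBun) (Y := 𝓕.toDBun) f
  comp_id {𝓔 𝓕} f := Category.comp_id (X := 𝓔.toDBun) (Y := 𝓕.toDBun) f
  assoc {𝓔 𝓕 𝓖 𝓗} f g h :=
    Category.assoc (W := 𝓔.toDBun) (X := 𝓕.toDBun) (Y := 𝓖.toDBun) (Z := 𝓗.toDBun) f g h

/-! ## From differential bundles to modules -/

section ToModule

variable {R : CommRingCat.{u}}

/-- The ring `E` of a differential bundle over `R`, as an `R`-algebra via `q : R → E`. -/
def DBunData.Total (𝓔 : DBunData R) : Type u := 𝓔.E.unop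

instance (𝓔 : DBunData R) : CommRing 𝓔.Total := 𝓔.E.unop.commRing

/-- The projection, as a ring morphism `R → E`. -/
def DBunData.qRing (𝓔 : DBunData R) : R →+* 𝓔.Total := 𝓔.q.unop.hom

/-- The lift, as a ring morphism `T(E) → E`. -/
def DBunData.lamRing (𝓔 : DBunData R) : TRing 𝓔.Total →+* 𝓔.Total := 𝓔.lam.unop.hom

instance (𝓔 : DBunData R) : Algebra R 𝓔.Total := 𝓔.qRing.toAlgebra

/-- The map `D_λ : E → E`, `x ↦ λ(d(x))`. -/
def DBunData.D (𝓔 : DBunData R) (x : 𝓔.Total) : 𝓔.Total := 𝓔.lamRing (TRing.d 𝓔.Total x)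

theorem DBun.lamRing_comp (𝓔 : DBun R) :
    𝓔.lamRing.comp (TRing.map 𝓔.qRing) = 𝓔.qRing.comp (TRing.zero R) := by
  have h := congrArg (fun k => CommRingCat.Hom.hom (Quiver.Hom.unop k))
    𝓔.isDifferentialBundle.lift_proj
  exact h

theorem DBun.D_smul (𝓔 : DBun R) (a : R) (x : 𝓔.Total) : 𝓔.D (a • x) = a • 𝓔.D x :=
  TRing.lift_d_smul 𝓔.qRing 𝓔.lamRing 𝓔.lamRing_comp a x

/-- `D_λ` as an `R`-linear map. -/
def DBun.linD (𝓔 : DBun R) : 𝓔.Total →ₗ[R] 𝓔.Total where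
  toFun := 𝓔.D
  map_add' x y := by simp [DBunData.D]
  map_smul' a x := 𝓔.D_smul a x

/-- The image of `D_λ` as an `R`-submodule of `E`; the action is
`a • D_λ x = q(a) D_λ(x) = D_λ(q(a) x)`. -/
def DBun.imD (𝓔 : DBun R) : Submodule R 𝓔.Total := LinearMap.range 𝓔.linD

/-- The `R`-module `im(D_λ)` attached to a differential bundle. -/
def DBun.toModule (𝓔 : DBun R) : ModuleCat.{u} R := ModuleCat.of R 𝓔.imD

/-- The inclusion `im(D_λ) → E`. -/
def DBun.incl (𝓔 : DBun R) : 𝓔.toModule →ₗ[R] 𝓔.Total := 𝓔.imD.subtype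

end ToModule

/-! ## From modules to differential bundles -/

section OfModule

/-- For ring morphisms `u, v : Sym_R(M) → B` that agree on `R`, the ring morphism `Sym_R(M) → B`
with `a ↦ u(a) = v(a)`, `m ↦ u(m) + v(m)`. -/
def symAdd {R M B : Type u} [CommRing R] [AddCommGroup M] [Module R M] [CommRing B]
    (u v : SymmetricAlgebra R M →+* B)
    (h : u.comp (algebraMap R (SymmetricAlgebra R M)) =
      v.comp (algebraMap R (SymmetricAlgebra R M))) : SymmetricAlgebra R M →+* B :=
  letI : Algebra R B := (u.comp (algebraMap R (SymmetricAlgebra R M))).toAlgebra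
  (SymmetricAlgebra.lift
    { toFun := fun m => u (SymmetricAlgebra.ι R M m) + v (SymmetricAlgebra.ι R M m)
      map_add' := fun m n => by
        rw [map_add, map_add, map_add]
        ring
      map_smul' := fun a m => by
        have h' : v (algebraMap R (SymmetricAlgebra R M) a) =
            u (algebraMap R (SymmetricAlgebra R M) a) := (RingHom.congr_fun h a).symm
        rw [map_smul, Algebra.smul_def, map_mul, map_mul, h', ← mul_add]
        rfl }).toRingHom

variable (R : CommRingCat.{u}) (M : ModuleCat.{u} R)

/-- The total space `Sym_R(M)`. -/
abbrev symE : Aff.{u} := op (CommRingCat.of (SymmetricAlgebra R M))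

/-- The projection `q_M : R → Sym_R(M)`, `a ↦ a`. -/
def symProj : symE R M ⟶ op R :=
  (CommRingCat.ofHom (algebraMap R (SymmetricAlgebra R M))).op

/-- The sum `σ_M`: `a ↦ π_1(a) = π_2(a)`, `m ↦ π_1(m) + π_2(m)`
(that is, `m ⊗ 1 + 1 ⊗ m`). -/
def symSum : Fib (symProj R M) 2 ⟶ symE R M :=
  (CommRingCat.ofHom (symAdd (R := R) (M := M)
    (prj (symProj R M) 2 0).unop.hom (prj (symProj R M) 2 1).unop.hom
    (congrArg (fun k : Fib (symProj R M) 2 ⟶ op R => k.unop.hom)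
      (prj_eq (symProj R M) 2 0 1)))).op

/-- The zero `z_M : Sym_R(M) → R`, `a ↦ a`, `m ↦ 0`. -/
def symZero : op R ⟶ symE R M :=
  (CommRingCat.ofHom (SymmetricAlgebra.lift (0 : M →ₗ[R] R)).toRingHom).op

/-- The negative `ι_M : Sym_R(M) → Sym_R(M)`, `a ↦ a`, `m ↦ -m`. -/
def symNeg : symE R M ⟶ symE R M :=
  (CommRingCat.ofHom (SymmetricAlgebra.lift (-SymmetricAlgebra.ι R M)).toRingHom).op

/-- The ring morphism `Sym_R(M) → Sym_R(M)[ε]`, `a ↦ a`, `m ↦ m ε`. -/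
def symEps : SymmetricAlgebra R M →+* DualNumber (SymmetricAlgebra R M) :=
  (SymmetricAlgebra.lift
    ((TrivSqZeroExt.inrHom (SymmetricAlgebra R M) (SymmetricAlgebra R M)).restrictScalars R ∘ₗ
      SymmetricAlgebra.ι R M)).toRingHom

/-- The lift `λ_M : T(Sym_R(M)) → Sym_R(M)`, `a ↦ a`, `m ↦ 0`, `d(a) ↦ 0`, `d(m) ↦ m`. -/
def symLift : symE R M ⟶ T.obj (symE R M) :=
  (CommRingCat.ofHom (TRing.sharp (symEps R M))).op

/-- The quadruple `(q_M, σ_M, z_M, λ_M)` on `Sym_R(M)`. -/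
def symData : DBunData R where
  E := symE R M
  q := symProj R M
  σ := symSum R M
  z := symZero R M
  lam := symLift R M

/-- `Sym_R(M)` as a differential bundle with negatives, given that the axioms hold for it. -/
def symBun (h : (symData R M).IsDifferentialBundle)
    (h_neg : (symData R M).IsNegative (symNeg R M)) : DBunNeg R where
  toDBunData := symData R M
  isDifferentialBundle := h
  ι := symNeg R M
  isNegative := h_neg

end OfModule

/-- The map `ψ : E → Sym_R(im(D_λ))` of `CRING^op`: as a ring morphism `Sym_R(im(D_λ)) → E` it is
the morphism of `R`-algebras extending the inclusion `im(D_λ) → E`. -/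
def DBun.psi {R : CommRingCat.{u}} (𝓔 : DBun R) : 𝓔.E ⟶ symE R 𝓔.toModule :=
  Quiver.Hom.op (X := CommRingCat.of (SymmetricAlgebra R 𝓔.toModule)) (Y := 𝓔.E.unop)
    (CommRingCat.ofHom (S := 𝓔.Total) (SymmetricAlgebra.lift 𝓔.incl).toRingHom)

/-- The set of isomorphism classes of objects of a category. -/
abbrev IsoClasses (C : Type*) [Category C] : Type _ := Quotient (isIsomorphicSetoid C)

/-- The isomorphism class of an object. -/
abbrev isoClass {C : Type*} [Category C] (X : C) : IsoClasses C :=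
  Quotient.mk (isIsomorphicSetoid C) X

end AffTangent

end

open AffTangent

/-!
Differential bundles over `R` in affine schemes are the symmetric algebras of `R`-modules.

A map `X → T(Y)` of affine schemes is a map `v : X → Y` together with a derivation, along `v`, from
the ring of `Y` to the ring of `X`, that is, a ring morphism from the ring of `Y` to the dual
numbers over the ring of `X`.  So `T` is a right adjoint, and all its iterates preserve limits
(`Tpow_isRightAdjoint`).  The preservation axioms of a differential bundle are thus automatic, and
every identity between maps into tangent bundles can be checked on base points (`u ≫ p`) and
derivations (`der u`).

For `Sym_R(M)`, derivations and morphisms are determined by their values on `R` and `M`, where the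
axioms are immediate.  A tangent vector of `Sym_R(M)` over `R` is a base point together with an
`R`-linear map on `M`, hence a pair of points of `Sym_R(M)` over `R`; this is the universality of
`μ` (`isPullback_symMu`).

Conversely, let `E` be a differential bundle.  Restricting the pullback square of `μ` to the pairs
whose second entry is a zero gives: `λ` is a monomorphism onto the vertical tangent vectors at the
zero section (`eq_of_comp_lam`, `exists_comp_lam`).  In terms of rings, morphisms of `R`-algebras
`w : E → B` correspond to derivations `f : E → B` along the augmentation `q ∘ z` that vanish on
`R`, by `f = w ∘ D_λ`.  Since `D_λ` itself is such a derivation and is idempotent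
(`der_lam_der_lam`, from the compatibility of `λ` with `ℓ`), these derivations are the `R`-linear
maps `im(D_λ) → B`.  Hence `E` has the universal property of `Sym_R(im(D_λ))`
(`DBun.exists_psi_inv`), and, as `λ` is additive, a negative is the same as a morphism that is `-1`
on `im(D_λ)` (`isNegative_iff`), of which there is exactly one.
-/

noncomputable section

namespace AffTangent

/-! ### Maps of affine schemes on functions, and maps into tangent bundles as derivations -/

section Derivations

variable {W X Y Z : Aff.{u}}

/-- The ring morphism underlying a map of affine schemes. -/
def ev (f : X ⟶ Y) : Y.unop →+* X.unop := f.unop.hom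

theorem hom_ext_ev {f g : X ⟶ Y} (h : ∀ y, ev f y = ev g y) : f = g := by
  apply Quiver.Hom.unop_inj
  ext y
  exact h y

@[simp]
theorem ev_id (x : X.unop) : ev (𝟙 X) x = x := rfl

@[simp]
theorem ev_comp (f : X ⟶ Y) (g : Y ⟶ Z) (z : Z.unop) : ev (f ≫ g) z = ev f (ev g z) := rfl

/-- The derivation `a ↦ u(d(a))` along `u ≫ p` given by a map `u : X → T(Y)`. -/
def der (u : X ⟶ T.obj Y) : Y.unop →+ X.unop :=
  (RingHom.toAddMonoidHom u.unop.hom).comp (TRing.d Y.unop)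

theorem der_apply (u : X ⟶ T.obj Y) (y : Y.unop) : der u y = u.unop.hom (TRing.d Y.unop y) := rfl

theorem der_mul (u : X ⟶ T.obj Y) (x y : Y.unop) :
    der u (x * y) = ev (u ≫ p Y) x * der u y + ev (u ≫ p Y) y * der u x := by
  rw [der_apply, TRing.d_mul]
  exact (map_add u.unop.hom _ _).trans (congrArg₂ _ (map_mul _ _ _) (map_mul _ _ _))

@[simp]
theorem der_one (u : X ⟶ T.obj Y) : der u 1 = 0 := by
  have h := der_mul u 1 1
  simpa using h

/-- A map into a tangent bundle is determined by its base point and its derivation. -/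
theorem hom_T_ext {u v : X ⟶ T.obj Y} (h₀ : u ≫ p Y = v ≫ p Y)
    (h₁ : ∀ y, der u y = der v y) : u = v := by
  apply Quiver.Hom.unop_inj
  ext1
  exact TRing.hom_ext (R := Y.unop) (B := X.unop)
    (fun a => congrArg (fun k : X ⟶ Y => ev k a) h₀) h₁

/-- The map into a tangent bundle with given base point and derivation. -/
def ofDer (v : X ⟶ Y) (D : Y.unop →+ X.unop)
    (hD : ∀ a b, D (a * b) = ev v a * D b + ev v b * D a) : X ⟶ T.obj Y :=
  (CommRingCat.ofHom (TRing.lift (R := Y.unop) (B := X.unop) (ev v) D hD)).op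

@[simp]
theorem ofDer_p (v : X ⟶ Y) (D : Y.unop →+ X.unop)
    (hD : ∀ a b, D (a * b) = ev v a * D b + ev v b * D a) : ofDer v D hD ≫ p Y = v :=
  hom_ext_ev fun y => TRing.lift_incl (ev v) D hD y

@[simp]
theorem der_ofDer (v : X ⟶ Y) (D : Y.unop →+ X.unop)
    (hD : ∀ a b, D (a * b) = ev v a * D b + ev v b * D a) (y : Y.unop) :
    der (ofDer v D hD) y = D y :=
  TRing.lift_d (ev v) D hD y

@[simp]
theorem der_comp (f : W ⟶ X) (u : X ⟶ T.obj Y) (y : Y.unop) :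
    der (f ≫ u) y = ev f (der u y) := rfl

@[simp]
theorem der_map (f : Y ⟶ Z) (z : Z.unop) : der (T.map f) z = TRing.d Y.unop (ev f z) :=
  TRing.lift_d (R := Z.unop) _ _ _ z

theorem der_comp_map (u : X ⟶ T.obj Y) (f : Y ⟶ Z) (z : Z.unop) :
    der (u ≫ T.map f) z = der u (ev f z) :=
  congrArg u.unop.hom (der_map f z)

@[simp]
theorem map_p (f : X ⟶ Y) : T.map f ≫ p Y = p X ≫ f :=
  hom_ext_ev fun y => TRing.lift_incl (R := Y.unop) _ _ _ y

@[simp]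
theorem zero_p (X : Aff.{u}) : zero X ≫ p X = 𝟙 X :=
  hom_ext_ev fun x => TRing.lift_incl (R := X.unop) _ _ _ x

@[simp]
theorem der_zero (x : X.unop) : der (zero X) x = 0 :=
  TRing.lift_d (R := X.unop) _ _ _ x

@[simp]
theorem vlift_p (X : Aff.{u}) : vlift X ≫ p (T.obj X) = p X ≫ zero X := by
  apply hom_T_ext
  · rw [Category.assoc, Category.assoc, zero_p]
    exact hom_ext_ev fun x => TRing.vlift_incl_incl x
  · intro x
    rw [der_comp _ (zero X), der_zero, map_zero]
    exact TRing.vlift_incl_d x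

@[simp]
theorem der_vlift_d (x : X.unop) :
    der (vlift X) (TRing.d X.unop x) = TRing.d X.unop x :=
  TRing.vlift_d_d x

@[simp]
theorem der_vlift_incl (x : X.unop) : der (vlift X) (ev (p X) x) = 0 :=
  TRing.vlift_d_incl x

/-- A map into an iterated tangent bundle `T(T(Y))` is determined by its base point and by the
values of its derivation on the generators `a` and `d(a)` of the ring of `T(Y)`. -/
theorem hom_TT_ext {u v : X ⟶ T.obj (T.obj Y)} (h₀ : u ≫ p (T.obj Y) = v ≫ p (T.obj Y))
    (h₁ : ∀ y, der u (ev (p Y) y) = der v (ev (p Y) y))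
    (h₂ : ∀ y, der u (TRing.d Y.unop y) = der v (TRing.d Y.unop y)) : u = v := by
  refine hom_T_ext h₀ fun t => ?_
  have hmul (w : X ⟶ T.obj (T.obj Y)) (a b : TRing Y.unop) :
      der w (a * b : TRing Y.unop) = ev (w ≫ p (T.obj Y)) a * der w b +
        ev (w ≫ p (T.obj Y)) b * der w a := der_mul w a b
  have hadd (w : X ⟶ T.obj (T.obj Y)) (a b : TRing Y.unop) :
      der w (a + b : TRing Y.unop) = der w a + der w b := map_add (der w) a b
  induction t using SymmetricAlgebra.induction with
  | algebraMap r => exact h₁ r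
  | ι m =>
    have hm : m ∈ Submodule.span Y.unop (Set.range (KaehlerDifferential.D ℤ Y.unop)) := by
      rw [KaehlerDifferential.span_range_derivation]; trivial
    induction hm using Submodule.span_induction with
    | mem x hx => obtain ⟨y, rfl⟩ := hx; exact h₂ y
    | zero => rw [map_zero]; exact (map_zero (der u)).trans (map_zero (der v)).symm
    | add x y _ _ hx hy => rw [map_add, hadd, hadd, hx, hy]
    | smul a x _ hx =>
      rw [map_smul, Algebra.smul_def, hmul, hmul, hx, h₀]
      congr 2
      exact h₁ a
  | mul a b ha hb => rw [hmul, hmul, ha, hb, h₀]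
  | add a b ha hb => rw [hadd, hadd, ha, hb]

end Derivations

/-! ### The tangent bundle functor is a right adjoint -/

section Adjunction

/-- Maps `X → T(Y)` are ring morphisms from the ring of `Y` to the dual numbers over the ring
of `X`. -/
def dualNumberEquiv (X Y : Aff.{u}) :
    (op (CommRingCat.of (DualNumber X.unop)) ⟶ Y) ≃ (X ⟶ T.obj Y) where
  toFun f := (CommRingCat.ofHom (TRing.sharp (R := Y.unop) (B := X.unop) (ev f))).op
  invFun u := Quiver.Hom.op (X := Y.unop) (Y := CommRingCat.of (DualNumber X.unop))
    (CommRingCat.ofHom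
      { toFun := fun y => (ev (u ≫ p Y) y, der u y)
        map_one' := TrivSqZeroExt.ext (map_one _) (der_one u)
        map_zero' := TrivSqZeroExt.ext (map_zero _) (map_zero _)
        map_mul' := fun _ _ => TrivSqZeroExt.ext (map_mul _ _ _)
          ((der_mul u _ _).trans (congrArg _ (mul_comm _ _)))
        map_add' := fun _ _ => TrivSqZeroExt.ext (map_add _ _ _) (map_add _ _ _) })
  left_inv _ := hom_ext_ev fun y => TrivSqZeroExt.ext
    (TRing.lift_incl (R := Y.unop) (B := X.unop) _ _ _ y)
    (TRing.lift_d (R := Y.unop) (B := X.unop) _ _ _ y)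
  right_inv _ := hom_T_ext
    (hom_ext_ev fun y => TRing.lift_incl (R := Y.unop) (B := X.unop) _ _ _ y)
    (fun y => TRing.lift_d (R := Y.unop) (B := X.unop) _ _ _ y)

theorem ev_dualNumberEquiv_p (X Y : Aff.{u}) (f : op (CommRingCat.of (DualNumber X.unop)) ⟶ Y)
    (y : Y.unop) : ev (dualNumberEquiv X Y f ≫ p Y) y =
      TrivSqZeroExt.fst (M := X.unop) (ev f y) :=
  TRing.lift_incl (R := Y.unop) (B := X.unop) _ _ _ y

theorem der_dualNumberEquiv (X Y : Aff.{u}) (f : op (CommRingCat.of (DualNumber X.unop)) ⟶ Y)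
    (y : Y.unop) : der (dualNumberEquiv X Y f) y = TrivSqZeroExt.snd (R := X.unop) (ev f y) :=
  TRing.lift_d (R := Y.unop) (B := X.unop) _ _ _ y

/-- Passing from `X` to the spectrum of the dual numbers over its ring is left adjoint to `T`. -/
instance : T.{u}.IsRightAdjoint :=
  (Adjunction.adjunctionOfEquivLeft dualNumberEquiv fun X Y Y' g h => by
    refine hom_T_ext (hom_ext_ev fun y => ?_) fun y => ?_
    · rw [Category.assoc, map_p, ← Category.assoc, ev_comp _ g, ev_dualNumberEquiv_p,
        ev_dualNumberEquiv_p, ev_comp]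
    · rw [der_comp_map, der_dualNumberEquiv, der_dualNumberEquiv, ev_comp]).isRightAdjoint

instance Tpow_isRightAdjoint : ∀ m, (Tpow.{u} m).IsRightAdjoint
  | 0 => inferInstanceAs (𝟭 _ : Aff.{u} ⥤ Aff.{u}).IsRightAdjoint
  | m + 1 =>
    have := Tpow_isRightAdjoint m
    inferInstanceAs (Tpow m ⋙ T).IsRightAdjoint

end Adjunction

/-! ### Fibre powers -/

section FibrePowers

variable {X Y E A : Aff.{u}} {q : E ⟶ A}

attribute [simp] fibPair_fst fibPair_snd tanPair_fst tanPair_snd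

theorem fib_hom_ext {s t : X ⟶ Fib q 2} (h₀ : s ≫ prj q 2 0 = t ≫ prj q 2 0)
    (h₁ : s ≫ prj q 2 1 = t ≫ prj q 2 1) : s = t := by
  refine WidePullback.hom_ext _ _ _ ?_ ?_
  · intro j
    fin_cases j
    exacts [h₀, h₁]
  · rw [← WidePullback.π_arrow (fun _ : Fin 2 => q) 0, reassoc_of% h₀]

theorem comp_fibPair (s : Y ⟶ X) (f g : X ⟶ E) (h : f ≫ q = g ≫ q) :
    s ≫ fibPair f g h = fibPair (s ≫ f) (s ≫ g) (by simp [h]) :=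
  fib_hom_ext (by simp) (by simp)

variable
  (hT : PreservesLimit (WidePullbackShape.wideCospan A (fun _ : Fin 2 => E) fun _ => q) T)

@[simp]
theorem der_tanPair_fst (f g : X ⟶ T.obj E) (h : f ≫ T.map q = g ≫ T.map q) (y : E.unop) :
    der (tanPair hT f g h) (ev (prj q 2 0) y) = der f y := by
  rw [← der_comp_map, tanPair_fst]

@[simp]
theorem der_tanPair_snd (f g : X ⟶ T.obj E) (h : f ≫ T.map q = g ≫ T.map q) (y : E.unop) :
    der (tanPair hT f g h) (ev (prj q 2 1) y) = der g y := by
  rw [← der_comp_map, tanPair_snd]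

/-- Projecting the pairing into `T(E_2)` to `E_2` gives the pairing of the base points. -/
theorem tanPair_p (f g : X ⟶ T.obj E) (h : f ≫ T.map q = g ≫ T.map q) :
    tanPair hT f g h ≫ p _ = fibPair (f ≫ p E) (g ≫ p E)
      (by rw [Category.assoc, Category.assoc, ← map_p, reassoc_of% h]) :=
  fib_hom_ext (by rw [Category.assoc, ← map_p, reassoc_of% (tanPair_fst hT f g h), fibPair_fst])
    (by rw [Category.assoc, ← map_p, reassoc_of% (tanPair_snd hT f g h), fibPair_snd])

/-- `T` preserves the pullback `E_2`, so maps into `T(E_2)` are determined by their components. -/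
theorem hom_T_fib_ext {s t : X ⟶ T.obj (Fib q 2)}
    (h₀ : s ≫ T.map (prj q 2 0) = t ≫ T.map (prj q 2 0))
    (h₁ : s ≫ T.map (prj q 2 1) = t ≫ T.map (prj q 2 1)) : s = t := by
  refine (isLimitOfPreserves T (limit.isLimit (WidePullbackShape.wideCospan A
    (fun _ : Fin 2 => E) fun _ => q))).hom_ext ?_
  rintro (_ | j)
  · change s ≫ T.map (WidePullback.base fun _ : Fin 2 => q) = t ≫ T.map (WidePullback.base _)
    rw [← WidePullback.π_arrow (fun _ : Fin 2 => q) 0, T.map_comp, reassoc_of% h₀]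
  · fin_cases j
    exacts [h₀, h₁]

theorem comp_tanPair (s : Y ⟶ X) (f g : X ⟶ T.obj E) (h : f ≫ T.map q = g ≫ T.map q) :
    s ≫ tanPair hT f g h = tanPair hT (s ≫ f) (s ≫ g) (by simp [h]) :=
  hom_T_fib_ext (by simp) (by simp)

theorem tanPair_map (u : X ⟶ T.obj Y) (f g : Y ⟶ E) (h : f ≫ q = g ≫ q) :
    tanPair hT (u ≫ T.map f) (u ≫ T.map g)
      (by rw [Category.assoc, Category.assoc, ← T.map_comp, ← T.map_comp, h]) =
      u ≫ T.map (fibPair f g h) :=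
  hom_T_fib_ext (by simp [← T.map_comp]) (by simp [← T.map_comp])

theorem plus_p (X : Aff.{u}) : plus X ≫ p X = prj (p X) 2 0 ≫ p X :=
  hom_ext_ev fun x => TRing.lift_incl (R := X.unop) (B := (Fib (p X) 2).unop) _ _ _ x

theorem der_plus (x : X.unop) :
    der (plus X) x = der (prj (p X) 2 0) x + der (prj (p X) 2 1) x :=
  TRing.lift_d (R := X.unop) (B := (Fib (p X) 2).unop) _ _ _ x

theorem der_comp_plus (s : Y ⟶ Fib (p X) 2) (x : X.unop) :
    der (s ≫ plus X) x = der (s ≫ prj (p X) 2 0) x + der (s ≫ prj (p X) 2 1) x := by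
  simp [der_plus]

end FibrePowers

/-! ### The lift of a differential bundle represents its vertical tangent vectors at zero -/

section Universal

variable {X E A : Aff.{u}} {q : E ⟶ A} {z : A ⟶ E} {lam : E ⟶ T.obj E}
  (h_lam : lam ≫ T.map q = q ≫ zero A)

/-- The map `μ = T(σ) ∘ ⟨λ ∘ π_1, 0 ∘ π_2⟩ : E_2 → T(E)` of the universality axiom. -/
def mu (σ : Fib q 2 ⟶ E) (h_lam : lam ≫ T.map q = q ≫ zero A) : Fib q 2 ⟶ T.obj E :=
  tanPair inferInstance (prj q 2 0 ≫ lam) (prj q 2 1 ≫ zero E)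
    (by rw [Category.assoc, Category.assoc, h_lam, zero_naturality, ← Category.assoc,
      ← Category.assoc, prj_eq q 2 0 1]) ≫ T.map σ

include h_lam in
theorem comp_lam_map_proj (w : X ⟶ E) : (w ≫ lam) ≫ T.map q = (w ≫ q) ≫ zero A := by
  rw [Category.assoc, h_lam, Category.assoc]

theorem comp_zero_map (w : X ⟶ E) : (w ≫ zero E) ≫ T.map q = (w ≫ q) ≫ zero A := by
  rw [Category.assoc, zero_naturality, Category.assoc]

theorem comp_mu (σ : Fib q 2 ⟶ E) (s : X ⟶ Fib q 2) :
    s ≫ mu σ h_lam = tanPair inferInstance ((s ≫ prj q 2 0) ≫ lam) ((s ≫ prj q 2 1) ≫ zero E)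
      (by rw [comp_lam_map_proj h_lam, comp_zero_map, Category.assoc s (prj q 2 0) q,
        Category.assoc s (prj q 2 1) q, prj_eq q 2 0 1]) ≫ T.map σ := by
  rw [mu, ← Category.assoc, comp_tanPair]
  congr 2

theorem mu_map_proj {σ : Fib q 2 ⟶ E} (hσ : σ ≫ q = prj q 2 0 ≫ q) :
    mu σ h_lam ≫ T.map q = (prj q 2 0 ≫ q) ≫ zero A := by
  rw [mu, Category.assoc, ← T.map_comp, hσ, T.map_comp, ← Category.assoc, tanPair_fst,
    comp_lam_map_proj h_lam]

/-- The tangent vector `μ(x, y)` is based at `y`. -/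
theorem comp_mu_p {σ : Fib q 2 ⟶ E} (hz : z ≫ q = 𝟙 A) (h_p : lam ≫ p E = q ≫ z)
    (h_zero : fibPair (q ≫ z) (𝟙 E) (by simp [hz]) ≫ σ = 𝟙 E) (s : X ⟶ Fib q 2) :
    (s ≫ mu σ h_lam) ≫ p E = s ≫ prj q 2 1 := by
  have h₁ : (s ≫ mu σ h_lam) ≫ p E = (s ≫ prj q 2 1) ≫ fibPair (q ≫ z) (𝟙 E)
      (by simp [hz]) ≫ σ := by
    rw [comp_mu, Category.assoc, map_p, ← Category.assoc, tanPair_p,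
      ← Category.assoc (s ≫ prj q 2 1), comp_fibPair]
    congr 1
    refine fib_hom_ext ?_ ?_
    · rw [fibPair_fst, fibPair_fst, Category.assoc, Category.assoc, h_p, Category.assoc,
        reassoc_of% prj_eq q 2 0 1]
    · rw [fibPair_snd, fibPair_snd, Category.assoc, zero_p]
  rw [h₁, h_zero, Category.comp_id]

end Universal

namespace DBunData.IsDifferentialBundle

variable {R : CommRingCat.{u}} {𝓔 : DBunData R} (h : 𝓔.IsDifferentialBundle) {X : Aff.{u}}

include h

theorem isPullback_mu : IsPullback (mu 𝓔.σ h.lift_proj) (prj 𝓔.q 2 0 ≫ 𝓔.q)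
    (T.map 𝓔.q) (zero (op R)) :=
  h.universal 0

/-- `μ(x, 0) = λ(x)`. -/
theorem fibPair_mu (w : X ⟶ 𝓔.E) :
    fibPair (q := 𝓔.q) w (w ≫ 𝓔.q ≫ 𝓔.z) (by simp [h.zero_proj]) ≫ mu 𝓔.σ h.lift_proj =
      w ≫ 𝓔.lam := by
  have h₁ : (w ≫ 𝓔.q ≫ 𝓔.z) ≫ zero 𝓔.E = (w ≫ 𝓔.lam) ≫ T.map (𝓔.q ≫ 𝓔.z) := by
    rw [T.map_comp, ← Category.assoc _ (T.map 𝓔.q), comp_lam_map_proj h.lift_proj,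
      Category.assoc _ _ (T.map 𝓔.z), zero_naturality]
    simp only [Category.assoc]
  have h₂ := tanPair_map (q := 𝓔.q) inferInstance (w ≫ 𝓔.lam) (𝟙 𝓔.E) (𝓔.q ≫ 𝓔.z)
    (by simp [h.zero_proj])
  rw [comp_mu]
  simp only [fibPair_fst, fibPair_snd, h₁]
  simp only [T.map_id, Category.comp_id] at h₂
  rw [h₂, Category.assoc, ← T.map_comp, h.sum_zero, T.map_id, Category.comp_id]

/-- `λ` is a monomorphism, because `μ` and `q` jointly are and `μ(x, 0) = λ(x)`. -/
theorem eq_of_comp_lam {w w' : X ⟶ 𝓔.E} (hw : w ≫ 𝓔.lam = w' ≫ 𝓔.lam) : w = w' := by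
  have hz : w ≫ 𝓔.q ≫ 𝓔.z = w' ≫ 𝓔.q ≫ 𝓔.z := by
    rw [← h.lift_p, ← Category.assoc, hw, Category.assoc]
  have hq : w ≫ 𝓔.q = w' ≫ 𝓔.q := by
    have := congrArg (· ≫ 𝓔.q) hz
    simpa [h.zero_proj] using this
  have key : fibPair (q := 𝓔.q) w (w ≫ 𝓔.q ≫ 𝓔.z) (by simp [h.zero_proj]) =
      fibPair (q := 𝓔.q) w' (w' ≫ 𝓔.q ≫ 𝓔.z) (by simp [h.zero_proj]) := by
    apply h.isPullback_mu.hom_ext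
    · rw [h.fibPair_mu, h.fibPair_mu, hw]
    · rw [reassoc_of% fibPair_fst (q := 𝓔.q) w, reassoc_of% fibPair_fst (q := 𝓔.q) w', hq]
  rw [← fibPair_fst (q := 𝓔.q) w (w ≫ 𝓔.q ≫ 𝓔.z) (by simp [h.zero_proj]), key, fibPair_fst]

/-- A tangent vector of `E` that is based at a zero `z(b)` and vertical is the lift of a point of
`E` over `b`: the universality of `μ`, restricted to those pairs whose second entry is a zero. -/
theorem exists_comp_lam (v : X ⟶ T.obj 𝓔.E) (b : X ⟶ op R) (hp : v ≫ p 𝓔.E = b ≫ 𝓔.z)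
    (hq : v ≫ T.map 𝓔.q = b ≫ zero (op R)) : ∃ w : X ⟶ 𝓔.E, w ≫ 𝓔.q = b ∧ w ≫ 𝓔.lam = v := by
  obtain ⟨s, hs₁, hs₂⟩ : ∃ s, s ≫ mu 𝓔.σ h.lift_proj = v ∧ s ≫ prj 𝓔.q 2 0 ≫ 𝓔.q = b :=
    ⟨h.isPullback_mu.lift v b hq, h.isPullback_mu.lift_fst _ _ _, h.isPullback_mu.lift_snd _ _ _⟩
  have h₁ : s ≫ prj 𝓔.q 2 1 = b ≫ 𝓔.z := by
    rw [← comp_mu_p h.lift_proj h.zero_proj h.lift_p h.zero_sum, hs₁, hp]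
  refine ⟨s ≫ prj 𝓔.q 2 0, by rw [Category.assoc, hs₂], ?_⟩
  rw [← h.fibPair_mu, ← hs₁]
  congr 1
  refine fib_hom_ext (by simp) ?_
  rw [fibPair_snd, h₁, ← hs₂]
  simp only [Category.assoc]

/-! ### The derivation `D_λ` -/

/-- `D_λ` is a derivation along the augmentation `q ∘ z`. -/
theorem der_lam_mul (x y : 𝓔.E.unop) : der 𝓔.lam (x * y) =
    ev 𝓔.q (ev 𝓔.z x) * der 𝓔.lam y + ev 𝓔.q (ev 𝓔.z y) * der 𝓔.lam x := by
  rw [der_mul, h.lift_p, ev_comp, ev_comp]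

theorem der_lam_q (a : R) : der 𝓔.lam (ev 𝓔.q a) = 0 := by
  rw [← der_comp_map, h.lift_proj, der_comp, der_zero, map_zero]

theorem ev_z_der_lam (x : 𝓔.E.unop) : ev 𝓔.z (der 𝓔.lam x) = 0 := by
  rw [← der_comp, h.zero_lift, der_comp, der_zero, map_zero]

/-- `D_λ` is idempotent, by the compatibility of `λ` with the vertical lift. -/
theorem der_lam_der_lam (x : 𝓔.E.unop) : der 𝓔.lam (der 𝓔.lam x) = der 𝓔.lam x := by
  calc der 𝓔.lam (der 𝓔.lam x)
      = der (𝓔.lam ≫ T.map 𝓔.lam) (TRing.d 𝓔.E.unop x) :=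
        (der_comp_map 𝓔.lam 𝓔.lam (TRing.d 𝓔.E.unop x)).symm
    _ = ev 𝓔.lam (der (vlift 𝓔.E) (TRing.d 𝓔.E.unop x)) := by
        rw [h.lift_lift]
        rfl
    _ = der 𝓔.lam x := congrArg (ev 𝓔.lam) (der_vlift_d x)

/-- Maps into `E` over `R` are determined by their values, as ring morphisms, on `im(D_λ)`. -/
theorem hom_ext_der_lam {w w' : X ⟶ 𝓔.E} (hq : w ≫ 𝓔.q = w' ≫ 𝓔.q)
    (hD : ∀ x, ev w (der 𝓔.lam x) = ev w' (der 𝓔.lam x)) : w = w' := by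
  refine h.eq_of_comp_lam (hom_T_ext ?_ hD)
  rw [Category.assoc, h.lift_p, Category.assoc, h.lift_p, reassoc_of% hq]

/-- Every derivation along the augmentation that vanishes on `R` factors through `D_λ` by a map
into `E`. -/
theorem exists_ev_der_lam (b : X ⟶ op R) (f : 𝓔.E.unop →+ X.unop)
    (hf : ∀ x y, f (x * y) = ev (b ≫ 𝓔.z) x * f y + ev (b ≫ 𝓔.z) y * f x)
    (hfq : ∀ a, f (ev 𝓔.q a) = 0) :
    ∃ w : X ⟶ 𝓔.E, w ≫ 𝓔.q = b ∧ ∀ x, ev w (der 𝓔.lam x) = f x := by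
  obtain ⟨w, hw, hw'⟩ := h.exists_comp_lam (ofDer (b ≫ 𝓔.z) f hf) b (by simp)
    (hom_T_ext (by
        rw [Category.assoc, map_p, ← Category.assoc, ofDer_p, Category.assoc, h.zero_proj,
          Category.assoc, zero_p]) fun a => by
      rw [der_comp_map, der_ofDer, der_comp, der_zero, map_zero]
      exact hfq a)
  refine ⟨w, hw, fun x => ?_⟩
  rw [← der_comp, hw', der_ofDer]

/-- Since `λ` is additive over `z`, negatives are the maps over `R` that are `-1` on the image of
`D_λ`. -/
theorem isNegative_iff (ι : 𝓔.E ⟶ 𝓔.E) : 𝓔.IsNegative ι ↔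
    ι ≫ 𝓔.q = 𝓔.q ∧ ∀ x, ev ι (der 𝓔.lam x) = -der 𝓔.lam x := by
  have key (f g : 𝓔.E ⟶ 𝓔.E) (hf : f ≫ 𝓔.q = 𝓔.q) (hg : g ≫ 𝓔.q = 𝓔.q) (x : 𝓔.E.unop) :
      ev (fibPair f g (hf.trans hg.symm) ≫ 𝓔.σ) (der 𝓔.lam x) =
        ev f (der 𝓔.lam x) + ev g (der 𝓔.lam x) := by
    rw [← der_comp, Category.assoc, h.lift_plus, ← Category.assoc, der_comp_plus, comp_fibPair,
      fibPair_fst, fibPair_snd, ← Category.assoc, ← Category.assoc, fibPair_fst, fibPair_snd]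
    rfl
  have hzero (x : 𝓔.E.unop) : ev (𝓔.q ≫ 𝓔.z) (der 𝓔.lam x) = 0 := by
    rw [ev_comp, h.ev_z_der_lam, map_zero]
  have hproj (f g : 𝓔.E ⟶ 𝓔.E) (hf : f ≫ 𝓔.q = 𝓔.q) (hg : g ≫ 𝓔.q = 𝓔.q) :
      (fibPair f g (hf.trans hg.symm) ≫ 𝓔.σ) ≫ 𝓔.q = (𝓔.q ≫ 𝓔.z) ≫ 𝓔.q := by
    rw [Category.assoc, h.sum_proj 0, ← Category.assoc, fibPair_fst, hf, Category.assoc,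
      h.zero_proj, Category.comp_id]
  refine ⟨fun hι => ⟨hι.neg_proj, fun x => ?_⟩, fun hι => ⟨hι.1, ?_, ?_⟩⟩
  · have h₁ := key (𝟙 _) ι (Category.id_comp _) hι.neg_proj x
    rw [hι.sum_neg, hzero, ev_id] at h₁
    exact (neg_eq_of_add_eq_zero_right h₁.symm).symm
  · refine h.hom_ext_der_lam (hproj _ _ (Category.id_comp _) hι.1) fun x => ?_
    rw [key _ _ (Category.id_comp _) hι.1, hzero, hι.2, ev_id, add_neg_cancel]
  · refine h.hom_ext_der_lam (hproj _ _ hι.1 (Category.id_comp _)) fun x => ?_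
    rw [key _ _ hι.1 (Category.id_comp _), hzero, hι.2, ev_id, neg_add_cancel]

theorem existsUnique_isNegative : ∃! ι : 𝓔.E ⟶ 𝓔.E, 𝓔.IsNegative ι := by
  -- The negative is the morphism that corresponds to the derivation `-D_λ`.
  obtain ⟨ι, hι, hι'⟩ := h.exists_ev_der_lam 𝓔.q (-der 𝓔.lam)
    (fun x y => by
      simp only [AddMonoidHom.neg_apply, h.der_lam_mul, ev_comp]
      ring)
    (fun a => by
      rw [AddMonoidHom.neg_apply, neg_eq_zero]
      exact h.der_lam_q a)
  refine ⟨ι, (h.isNegative_iff ι).2 ⟨hι, hι'⟩, fun κ hκ => ?_⟩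
  obtain ⟨hκ₁, hκ₂⟩ := (h.isNegative_iff κ).1 hκ
  exact h.hom_ext_der_lam (hκ₁.trans hι.symm) fun x => (hκ₂ x).trans (hι' x).symm

end DBunData.IsDifferentialBundle

/-! ### The differential bundle `Sym_R(M)` -/

section Sym

variable {R : CommRingCat.{u}} {M : ModuleCat.{u} R} {X : Aff.{u}}

variable (R M) in
/-- The generator `m` of the ring `Sym_R(M)`. -/
def gen (m : M) : (symE R M).unop := SymmetricAlgebra.ι R M m

variable (R M) in
theorem gen_smul (a : R) (m : M) : gen R M (a • m) = ev (symProj R M) a * gen R M m :=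
  (map_smul (SymmetricAlgebra.ι R M) a m).trans (Algebra.smul_def _ _)

variable (R M) in
theorem gen_add (m n : M) : gen R M (m + n) = gen R M m + gen R M n :=
  map_add (SymmetricAlgebra.ι R M) m n

theorem sym_induction {motive : (symE R M).unop → Prop}
    (h_proj : ∀ a : R, motive (ev (symProj R M) a)) (h_gen : ∀ m, motive (gen R M m))
    (h_mul : ∀ x y, motive x → motive y → motive (x * y))
    (h_add : ∀ x y, motive x → motive y → motive (x + y)) (x : (symE R M).unop) : motive x := by
  induction x using SymmetricAlgebra.induction (R := R) (M := M) with
  | algebraMap a => exact h_proj a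
  | ι m => exact h_gen m
  | mul x y hx hy => exact h_mul x y hx hy
  | add x y hx hy => exact h_add x y hx hy

theorem hom_symE_ext {f g : X ⟶ symE R M} (h_proj : f ≫ symProj R M = g ≫ symProj R M)
    (h_gen : ∀ m, ev f (gen R M m) = ev g (gen R M m)) : f = g := by
  refine hom_ext_ev (sym_induction (fun a => ?_) h_gen (fun x y hx hy => ?_) fun x y hx hy => ?_)
  · exact congrArg (fun k : X ⟶ op R => ev k a) h_proj
  · rw [map_mul, map_mul, hx, hy]
  · rw [map_add, map_add, hx, hy]

/-- A tangent vector of `Sym_R(M)` is determined by its projection to `R` and by the values on `M`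
of its base point and of its derivation. -/
theorem hom_T_symE_ext {u v : X ⟶ T.obj (symE R M)}
    (h_proj : u ≫ T.map (symProj R M) = v ≫ T.map (symProj R M))
    (h_p : ∀ m, ev (u ≫ p _) (gen R M m) = ev (v ≫ p _) (gen R M m))
    (h_gen : ∀ m, der u (gen R M m) = der v (gen R M m)) : u = v := by
  have h_base : u ≫ p _ = v ≫ p _ := by
    refine hom_symE_ext ?_ h_p
    rw [Category.assoc, ← map_p, ← Category.assoc, h_proj, Category.assoc, map_p, Category.assoc]
  refine hom_T_ext h_base (sym_induction (fun a => ?_) h_gen (fun x y hx hy => ?_)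
    fun x y hx hy => ?_)
  · rw [← der_comp_map, ← der_comp_map, h_proj]
  · rw [der_mul, der_mul, hx, hy, h_base]
  · rw [map_add, map_add, hx, hy]

/-- The map into the spectrum of `Sym_R(M)` with given base point and values on `M`. -/
def symHom (b : X ⟶ op R) (g : M →+ X.unop) (hg : ∀ (a : R) m, g (a • m) = ev b a * g m) :
    X ⟶ symE R M :=
  letI : Algebra R X.unop := (ev b).toAlgebra
  (CommRingCat.ofHom (SymmetricAlgebra.lift (R := R) (M := M) (A := X.unop)
    { g with map_smul' := hg }).toRingHom).op

section

variable (b : X ⟶ op R) (g : M →+ X.unop) (hg : ∀ (a : R) m, g (a • m) = ev b a * g m)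

theorem symHom_proj : symHom b g hg ≫ symProj R M = b := by
  let _ : Algebra R X.unop := (ev b).toAlgebra
  exact hom_ext_ev fun a => (SymmetricAlgebra.lift (R := R) (M := M) (A := X.unop)
    { g with map_smul' := hg }).commutes a

theorem ev_symHom_gen (m : M) : ev (symHom b g hg) (gen R M m) = g m := by
  let _ : Algebra R X.unop := (ev b).toAlgebra
  exact SymmetricAlgebra.lift_ι_apply (R := R) (M := M) (A := X.unop)
    ({ g with map_smul' := hg } : M →ₗ[R] X.unop) m

end

variable (R M)

theorem symSum_proj (j : Fin 2) :
    symSum R M ≫ symProj R M = prj (symProj R M) 2 j ≫ symProj R M := by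
  rw [prj_eq _ _ j 0]
  let _ : Algebra R (Fib (symProj R M) 2).unop :=
    (ev (prj (symProj R M) 2 0 ≫ symProj R M)).toAlgebra
  exact hom_ext_ev fun a => (SymmetricAlgebra.lift (R := R) (M := M)
    (A := (Fib (symProj R M) 2).unop) _).commutes a

theorem ev_symSum_gen (m : M) : ev (symSum R M) (gen R M m) =
    ev (prj (symProj R M) 2 0) (gen R M m) + ev (prj (symProj R M) 2 1) (gen R M m) := by
  let _ : Algebra R (Fib (symProj R M) 2).unop :=
    (ev (prj (symProj R M) 2 0 ≫ symProj R M)).toAlgebra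
  exact SymmetricAlgebra.lift_ι_apply (R := R) (M := M)
    (A := (Fib (symProj R M) 2).unop) _ m

theorem symZero_proj : symZero R M ≫ symProj R M = 𝟙 _ :=
  hom_ext_ev fun a => (SymmetricAlgebra.lift (0 : M →ₗ[R] R)).commutes a

theorem ev_symZero_gen (m : M) : ev (symZero R M) (gen R M m) = 0 :=
  SymmetricAlgebra.lift_ι_apply (0 : M →ₗ[R] R) m

theorem symNeg_proj : symNeg R M ≫ symProj R M = symProj R M :=
  hom_ext_ev fun a => (SymmetricAlgebra.lift (-SymmetricAlgebra.ι R M)).commutes a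

theorem ev_symNeg_gen (m : M) : ev (symNeg R M) (gen R M m) = -gen R M m :=
  SymmetricAlgebra.lift_ι_apply (-SymmetricAlgebra.ι R M) m

theorem symEps_algebraMap (a : R) : symEps R M (algebraMap R _ a) =
    TrivSqZeroExt.inl (algebraMap R (SymmetricAlgebra R M) a) :=
  (SymmetricAlgebra.lift _).commutes a

theorem symEps_ι (m : M) : symEps R M (SymmetricAlgebra.ι R M m) =
    TrivSqZeroExt.inr (SymmetricAlgebra.ι R M m) :=
  SymmetricAlgebra.lift_ι_apply _ m

theorem ev_symLift_p (x : SymmetricAlgebra R M) :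
    ev (symLift R M ≫ p _) x = (symEps R M x).fst :=
  TRing.lift_incl (R := SymmetricAlgebra R M) _ _ _ x

theorem der_symLift (x : SymmetricAlgebra R M) :
    der (symLift R M) x = (symEps R M x).snd :=
  TRing.lift_d (R := SymmetricAlgebra R M) _ _ _ x

theorem der_symLift_gen (m : M) : der (symLift R M) (gen R M m) = gen R M m :=
  (der_symLift R M _).trans (congrArg TrivSqZeroExt.snd (symEps_ι R M m))

theorem symLift_p : symLift R M ≫ p _ = symProj R M ≫ symZero R M := by
  refine hom_symE_ext (hom_ext_ev fun a => ?_) fun m => ?_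
  · rw [Category.assoc _ (symZero R M), symZero_proj, Category.comp_id, ev_comp]
    refine (ev_symLift_p R M _).trans ?_
    refine (congrArg _ (symEps_algebraMap R M a)).trans rfl
  · rw [ev_comp (symProj R M), ev_symZero_gen, map_zero]
    refine (ev_symLift_p R M _).trans ?_
    refine (congrArg _ (symEps_ι R M m)).trans rfl

theorem symLift_map_proj : symLift R M ≫ T.map (symProj R M) = symProj R M ≫ zero (op R) := by
  refine hom_T_ext ?_ fun a => ?_
  · rw [Category.assoc, map_p, ← Category.assoc, symLift_p, Category.assoc, symZero_proj,
      Category.assoc, zero_p]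
  · rw [der_comp_map, der_comp, der_zero, map_zero]
    exact (der_symLift R M _).trans (congrArg TrivSqZeroExt.snd (symEps_algebraMap R M a))

theorem symZero_lift : symZero R M ≫ symLift R M = symZero R M ≫ zero _ := by
  refine hom_T_symE_ext ?_ (fun m => ?_) fun m => ?_
  · rw [Category.assoc, symLift_map_proj, Category.assoc, zero_naturality]
  · rw [Category.assoc, symLift_p, reassoc_of% symZero_proj R M, Category.assoc, zero_p,
      Category.comp_id]
  · rw [der_comp, der_symLift_gen, ev_symZero_gen, der_comp, der_zero, map_zero]

/-- The image of `D_λ` on `Sym_R(M)` consists of the elements of degree one. -/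
theorem exists_gen_eq_der_symLift (x : (symE R M).unop) : ∃ m, der (symLift R M) x = gen R M m := by
  have hz (x) : ∃ a : R, ev (symLift R M ≫ p _) x = ev (symProj R M) a :=
    ⟨ev (symZero R M) x, by rw [symLift_p]; rfl⟩
  induction x using sym_induction with
  | h_proj a =>
    refine ⟨0, ?_⟩
    rw [← der_comp_map, symLift_map_proj, der_comp, der_zero, map_zero]
    exact (map_zero (SymmetricAlgebra.ι R M)).symm
  | h_gen m => exact ⟨m, der_symLift_gen R M m⟩
  | h_mul x y hx hy =>
    obtain ⟨m, hm⟩ := hx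
    obtain ⟨n, hn⟩ := hy
    obtain ⟨a, ha⟩ := hz x
    obtain ⟨b, hb⟩ := hz y
    exact ⟨a • n + b • m, by rw [der_mul, hm, hn, ha, hb, gen_add, gen_smul, gen_smul]⟩
  | h_add x y hx hy =>
    obtain ⟨m, hm⟩ := hx
    obtain ⟨n, hn⟩ := hy
    exact ⟨m + n, by rw [map_add, hm, hn, gen_add]⟩

/-- On the generators `d'(d(x))`, the compatibility with the vertical lift says that `D_λ` is
idempotent, which holds since it is the identity on the elements of degree one. -/
theorem symLift_lift : symLift R M ≫ T.map (symLift R M) = symLift R M ≫ vlift _ := by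
  have hp : (symLift R M ≫ T.map (symLift R M)) ≫ p _ = (symLift R M ≫ vlift _) ≫ p _ := by
    rw [Category.assoc, map_p, ← Category.assoc, symLift_p, Category.assoc, symZero_lift,
      Category.assoc, vlift_p, ← Category.assoc, ← Category.assoc, symLift_p]
  refine hom_TT_ext hp (fun x => ?_) fun x => ?_
  · rw [der_comp_map, ← ev_comp, symLift_p, ev_comp, ← der_comp_map, symLift_map_proj, der_comp,
      der_zero, map_zero, der_comp, der_vlift_incl, map_zero]
  · obtain ⟨m, hm⟩ := exists_gen_eq_der_symLift R M x
    calc der (symLift R M ≫ T.map (symLift R M)) (TRing.d _ x)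
        = der (symLift R M) (der (symLift R M) x) :=
          der_comp_map (symLift R M) (symLift R M) (TRing.d _ x)
      _ = der (symLift R M) x := by rw [hm, der_symLift_gen]
      _ = ev (symLift R M) (der (vlift _) (TRing.d _ x)) :=
          (congrArg (ev (symLift R M)) (der_vlift_d x)).symm

theorem ev_symSum_gen_comp (s : X ⟶ Fib (symProj R M) 2) (m : M) :
    ev (s ≫ symSum R M) (gen R M m) =
    ev (s ≫ prj (symProj R M) 2 0) (gen R M m) + ev (s ≫ prj (symProj R M) 2 1) (gen R M m) := by
  rw [ev_comp, ev_symSum_gen, map_add]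
  rfl

theorem ev_fibPair_symSum_gen (f g : X ⟶ symE R M) (h : f ≫ symProj R M = g ≫ symProj R M)
    (m : M) : ev (fibPair f g h ≫ symSum R M) (gen R M m) =
      ev f (gen R M m) + ev g (gen R M m) := by
  rw [ev_symSum_gen_comp, fibPair_fst, fibPair_snd]

theorem fibPair_symSum_proj (f g : X ⟶ symE R M) (h : f ≫ symProj R M = g ≫ symProj R M) :
    (fibPair f g h ≫ symSum R M) ≫ symProj R M = f ≫ symProj R M := by
  rw [Category.assoc, symSum_proj R M 0, ← Category.assoc, fibPair_fst]

theorem sym_zero_sum : fibPair (symProj R M ≫ symZero R M) (𝟙 _)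
    (by simp [symZero_proj]) ≫ symSum R M = 𝟙 (symE R M) :=
  hom_symE_ext (by rw [fibPair_symSum_proj, Category.assoc, symZero_proj,
    Category.comp_id, Category.id_comp]) fun m => by
      rw [ev_fibPair_symSum_gen, ev_comp, ev_symZero_gen, map_zero, zero_add]

theorem sym_sum_zero : fibPair (𝟙 _) (symProj R M ≫ symZero R M)
    (by simp [symZero_proj]) ≫ symSum R M = 𝟙 (symE R M) :=
  hom_symE_ext (by rw [fibPair_symSum_proj]) fun m => by
    rw [ev_fibPair_symSum_gen, ev_comp (symProj R M), ev_symZero_gen, map_zero, add_zero]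

theorem der_tanPair_symSum_gen (f g : X ⟶ T.obj (symE R M))
    (h : f ≫ T.map (symProj R M) = g ≫ T.map (symProj R M)) (m : M) :
    der (tanPair inferInstance f g h ≫ T.map (symSum R M)) (gen R M m) =
      der f (gen R M m) + der g (gen R M m) := by
  rw [der_comp_map, ev_symSum_gen, map_add, der_tanPair_fst, der_tanPair_snd]

theorem tanPair_symSum_proj (f g : X ⟶ T.obj (symE R M))
    (h : f ≫ T.map (symProj R M) = g ≫ T.map (symProj R M)) :
    (tanPair inferInstance f g h ≫ T.map (symSum R M)) ≫ T.map (symProj R M) =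
      f ≫ T.map (symProj R M) := by
  rw [Category.assoc, ← T.map_comp, symSum_proj R M 0, T.map_comp, ← Category.assoc, tanPair_fst]

theorem der_comp_mu_gen (s : X ⟶ Fib (symProj R M) 2) (m : M) :
    der (s ≫ mu (symSum R M) (symLift_map_proj R M)) (gen R M m) =
      ev (s ≫ prj (symProj R M) 2 0) (gen R M m) := by
  rw [comp_mu, der_tanPair_symSum_gen, der_comp, der_symLift_gen, der_comp, der_zero, map_zero,
    add_zero]

/-- The pullback property of `μ` for `Sym_R(M)`: the tangent vector `v` of `Sym_R(M)` corresponds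
to two points of `Sym_R(M)` over `b`, namely to its base point and to the point whose values on `M`
are those of the derivation of `v`. -/
theorem exists_comp_symMu (v : X ⟶ T.obj (symE R M)) (b : X ⟶ op R)
    (hv : v ≫ T.map (symProj R M) = b ≫ zero (op R)) :
    ∃ s, s ≫ mu (symSum R M) (symLift_map_proj R M) = v ∧
      s ≫ prj (symProj R M) 2 0 ≫ symProj R M = b := by
  have hb : (v ≫ p _) ≫ symProj R M = b := by
    rw [Category.assoc, ← map_p, ← Category.assoc, hv, Category.assoc, zero_p, Category.comp_id]
  have h_der (a : R) : der v (ev (symProj R M) a) = 0 := by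
    rw [← der_comp_map, hv, der_comp, der_zero, map_zero]
  let f : X ⟶ symE R M := symHom b
    { toFun := fun m => der v (gen R M m)
      map_zero' := (congrArg (der v) (map_zero (SymmetricAlgebra.ι R M))).trans (map_zero _)
      map_add' := fun m n => by rw [gen_add, map_add] }
    (fun a m => by
      refine (congrArg (der v) (gen_smul R M a m)).trans ?_
      rw [der_mul, h_der, mul_zero, add_zero, ← ev_comp, hb]
      rfl)
  have hf : f ≫ symProj R M = (v ≫ p _) ≫ symProj R M := (symHom_proj _ _ _).trans hb.symm
  refine ⟨fibPair f (v ≫ p _) hf, hom_T_symE_ext ?_ (fun m => ?_) fun m => ?_, ?_⟩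
  · rw [Category.assoc, mu_map_proj _ (symSum_proj R M 0), ← Category.assoc, ← Category.assoc,
      fibPair_fst, hf, hb, hv]
  · rw [comp_mu_p _ (symZero_proj R M) (symLift_p R M) (sym_zero_sum R M), fibPair_snd]
  · rw [der_comp_mu_gen, fibPair_fst]
    exact ev_symHom_gen _ _ _ m
  · rw [← Category.assoc, fibPair_fst, hf, hb]

theorem isPullback_symMu : IsPullback (mu (symSum R M) (symLift_map_proj R M))
    (prj (symProj R M) 2 0 ≫ symProj R M) (T.map (symProj R M)) (zero (op R)) := by
  have h (s : PullbackCone (T.map (symProj R M)) (zero (op R))) :=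
    exists_comp_symMu R M s.fst s.snd s.condition
  refine ⟨⟨mu_map_proj _ (symSum_proj R M 0)⟩, ⟨PullbackCone.IsLimit.mk _
    (fun s => (h s).choose) (fun s => (h s).choose_spec.1) (fun s => (h s).choose_spec.2)
    fun s t ht₁ ht₂ => ?_⟩⟩
  rw [← (h s).choose_spec.1] at ht₁
  rw [← (h s).choose_spec.2] at ht₂
  refine fib_hom_ext (hom_symE_ext ?_ fun m => ?_) ?_
  · rwa [Category.assoc, Category.assoc]
  · rw [← der_comp_mu_gen, ← der_comp_mu_gen, ht₁]
  · rw [← comp_mu_p (symLift_map_proj R M) (symZero_proj R M) (symLift_p R M) (sym_zero_sum R M),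
      ht₁, comp_mu_p _ (symZero_proj R M) (symLift_p R M) (sym_zero_sum R M)]

theorem sym_lift_sum : symSum R M ≫ symLift R M =
    tanPair inferInstance (prj (symProj R M) 2 0 ≫ symLift R M)
      (prj (symProj R M) 2 1 ≫ symLift R M)
      (by rw [comp_lam_map_proj (symLift_map_proj R M), comp_lam_map_proj (symLift_map_proj R M),
        prj_eq]) ≫ T.map (symSum R M) := by
  have h_lift {Y : Aff.{u}} (f : Y ⟶ symE R M) (m : M) :
      ev ((f ≫ symLift R M) ≫ p _) (gen R M m) = 0 := by
    rw [Category.assoc, symLift_p, ev_comp, ev_comp, ev_symZero_gen, map_zero, map_zero]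
  refine hom_T_symE_ext ?_ (fun m => ?_) fun m => ?_
  · rw [tanPair_symSum_proj, comp_lam_map_proj (symLift_map_proj R M),
      comp_lam_map_proj (symLift_map_proj R M), symSum_proj R M 0]
  · rw [h_lift, Category.assoc, map_p, ← Category.assoc, tanPair_p, ev_fibPair_symSum_gen, h_lift,
      h_lift, add_zero]
  · rw [der_tanPair_symSum_gen, der_comp, der_symLift_gen, ev_symSum_gen, der_comp, der_comp,
      der_symLift_gen]

theorem sym_lift_plus : symSum R M ≫ symLift R M =
    fibPair (q := p (symE R M)) (prj (symProj R M) 2 0 ≫ symLift R M)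
      (prj (symProj R M) 2 1 ≫ symLift R M)
      (by rw [Category.assoc, Category.assoc, symLift_p, ← Category.assoc, ← Category.assoc,
          prj_eq _ 2 0 1]) ≫ plus (symE R M) := by
  have h_lift {Y : Aff.{u}} (f : Y ⟶ symE R M) :
      (f ≫ symLift R M) ≫ p _ = (f ≫ symProj R M) ≫ symZero R M := by
    rw [Category.assoc, symLift_p, Category.assoc]
  have h_plus {Y : Aff.{u}} (s : Y ⟶ Fib (p (symE R M)) 2) :
      (s ≫ plus _) ≫ p _ = (s ≫ prj (p _) 2 0) ≫ p _ := by
    rw [Category.assoc, plus_p, Category.assoc]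
  have h_der (a : R) : der (symLift R M) (ev (symProj R M) a) = 0 := by
    rw [← der_comp_map, symLift_map_proj, der_comp, der_zero, map_zero]
  refine hom_T_symE_ext (hom_T_ext ?_ fun a => ?_) (fun m => ?_) fun m => ?_
  · rw [Category.assoc, Category.assoc _ _ (p _), map_p, ← Category.assoc, ← Category.assoc, h_plus,
      fibPair_fst, h_lift, h_lift, symSum_proj R M 0]
  · rw [der_comp_map, der_comp, h_der, map_zero, der_comp_map, der_comp_plus, fibPair_fst,
      fibPair_snd, der_comp, der_comp, h_der, map_zero, map_zero, add_zero]
  · rw [h_plus, fibPair_fst, h_lift, h_lift, symSum_proj R M 0]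
  · rw [der_comp_plus, fibPair_fst, fibPair_snd, der_comp, der_comp, der_comp, der_symLift_gen,
      ev_symSum_gen]

theorem symData_isDifferentialBundle : (symData R M).IsDifferentialBundle where
  preserves _ _ := inferInstance
  sum_proj := symSum_proj R M
  zero_proj := symZero_proj R M
  sum_assoc := by
    refine hom_symE_ext ?_ fun m => ?_
    · refine (fibPair_symSum_proj R M _ _ _).trans
        ((fibPair_symSum_proj R M _ _ _).trans ?_ |>.trans (fibPair_symSum_proj R M _ _ _).symm)
      rfl
    · refine (ev_fibPair_symSum_gen R M _ _ _ m).trans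
        (.trans ?_ (ev_fibPair_symSum_gen R M _ _ _ m).symm)
      refine (congrArg (· + _) (ev_fibPair_symSum_gen R M _ _ _ m)).trans
        (.trans ?_ (congrArg (_ + ·) (ev_fibPair_symSum_gen R M _ _ _ m)).symm)
      exact add_assoc _ _ _
  zero_sum := sym_zero_sum R M
  sum_zero := sym_sum_zero R M
  sum_comm := by
    refine hom_symE_ext ?_ fun m => ?_
    · exact (fibPair_symSum_proj R M _ _ _).trans (symSum_proj R M 1).symm
    · exact (ev_fibPair_symSum_gen R M _ _ _ m).trans
        ((add_comm _ _).trans (ev_symSum_gen R M m).symm)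
  lift_proj := symLift_map_proj R M
  lift_sum := sym_lift_sum R M
  lift_zero := by
    refine (symZero_lift R M).trans (zero_naturality _).symm
  lift_p := symLift_p R M
  lift_plus := sym_lift_plus R M
  zero_lift := symZero_lift R M
  lift_lift := symLift_lift R M
  universal m := (isPullback_symMu R M).map (Tpow m)

/-- The map `m ↦ -m` is a negative, since the image of `D_λ` is `M`. -/
theorem symData_isNegative : (symData R M).IsNegative (symNeg R M) :=
  ((symData_isDifferentialBundle R M).isNegative_iff _).2 ⟨symNeg_proj R M, fun x => by
    obtain ⟨m, hm⟩ := exists_gen_eq_der_symLift R M x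
    exact (congrArg _ hm).trans ((ev_symNeg_gen R M m).trans (congrArg _ hm).symm)⟩

theorem ι_injective : Function.Injective (SymmetricAlgebra.ι R M) := by
  -- Extend `m ↦ m` to `Sym_R(M) → R ⊕ M`, the trivial square-zero extension.
  let _ : Module Rᵐᵒᵖ M := Module.compHom _ ((RingHom.id R).fromOpposite mul_comm)
  have : IsCentralScalar R M := ⟨fun _ _ => rfl⟩
  intro m n h
  have := congrArg (fun x => (SymmetricAlgebra.lift (TrivSqZeroExt.inrHom R M) x).snd) h
  simpa using this

end Sym

variable {R : CommRingCat.{u}}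

/-! ### The two constructions on isomorphisms -/

/-- An isomorphism of total spaces that is a morphism of differential bundles is an isomorphism of
differential bundles. -/
def DBun.isoMk {𝓔 𝓕 : DBun R} (e : 𝓔.E ≅ 𝓕.E) (h_proj : e.hom ≫ 𝓕.q = 𝓔.q)
    (h_lift : 𝓔.lam ≫ T.map e.hom = e.hom ≫ 𝓕.lam) : 𝓔 ≅ 𝓕 where
  hom := ⟨e.hom, h_proj, h_lift⟩
  inv := ⟨e.inv, by rw [← h_proj, e.inv_hom_id_assoc], by
    rw [← cancel_epi e.hom, e.hom_inv_id_assoc, ← Category.assoc, ← h_lift, Category.assoc,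
      ← T.map_comp, e.hom_inv_id, T.map_id, Category.comp_id]⟩
  hom_inv_id := DBun.Hom.ext e.hom_inv_id
  inv_hom_id := DBun.Hom.ext e.inv_hom_id

/-- The morphisms of differential bundles with negatives are those of the underlying differential
bundles, and so are the isomorphisms. -/
def DBunNeg.isoEquiv (𝓔 𝓕 : DBunNeg R) : (𝓔.toDBun ≅ 𝓕.toDBun) ≃ (𝓔 ≅ 𝓕) where
  toFun e := ⟨e.hom, e.inv, e.hom_inv_id, e.inv_hom_id⟩
  invFun e := ⟨e.hom, e.inv, e.hom_inv_id, e.inv_hom_id⟩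
  left_inv _ := rfl
  right_inv _ := rfl

theorem DBun.exists_der_lam_eq {𝓔 : DBun R} (m : 𝓔.toModule) :
    ∃ x : 𝓔.E.unop, der 𝓔.lam x = 𝓔.incl m :=
  m.2

/-- The element `D_λ x` of `im(D_λ)`. -/
def DBun.toIm (𝓔 : DBun R) (x : 𝓔.E.unop) : 𝓔.toModule := ⟨der 𝓔.lam x, x, rfl⟩

/-- A morphism of differential bundles, as a ring morphism, maps the image of `D_λ` to the image
of `D_λ`. -/
def DBun.Hom.mapIm {𝓔 𝓕 : DBun R} (f : 𝓔.Hom 𝓕) : 𝓕.toModule →ₗ[R] 𝓔.toModule where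
  toFun m := ⟨ev f.hom (𝓕.incl m), by
    obtain ⟨x, hx⟩ := DBun.exists_der_lam_eq m
    refine ⟨ev f.hom x, ?_⟩
    change der 𝓔.lam (ev f.hom x) = _
    rw [← der_comp_map, f.lift, der_comp, hx]⟩
  map_add' m n := Subtype.ext (map_add (ev f.hom) (𝓕.incl m) (𝓕.incl n))
  map_smul' a m := Subtype.ext <| by
    refine (map_mul (ev f.hom) (ev 𝓕.q a) (𝓕.incl m)).trans ?_
    rw [← ev_comp, f.proj]
    rfl

/-- `𝓔 ↦ im(D_λ)` on isomorphisms. -/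
def DBun.toModuleIso {𝓔 𝓕 : DBun R} (e : 𝓔 ≅ 𝓕) : 𝓔.toModule ≅ 𝓕.toModule where
  hom := ModuleCat.ofHom e.inv.mapIm
  inv := ModuleCat.ofHom e.hom.mapIm
  hom_inv_id := by
    ext m
    exact Subtype.ext (congrArg (fun k : DBun.Hom 𝓔 𝓔 => ev k.hom (𝓔.incl m)) e.hom_inv_id)
  inv_hom_id := by
    ext m
    exact Subtype.ext (congrArg (fun k : DBun.Hom 𝓕 𝓕 => ev k.hom (𝓕.incl m)) e.inv_hom_id)

variable (R) in
/-- `Sym_R(M)` as a differential bundle with negatives. -/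
abbrev symBundle (M : ModuleCat.{u} R) : DBunNeg R :=
  symBun R M (symData_isDifferentialBundle R M) (symData_isNegative R M)

section SymMap

variable {M N : ModuleCat.{u} R}

/-- The map of total spaces given by `m ↦ f m`. -/
def symMap (f : M ⟶ N) : symE R N ⟶ symE R M :=
  symHom (symProj R N)
    { toFun := fun m => gen R N (f m)
      map_zero' := by
        rw [map_zero]
        exact map_zero (SymmetricAlgebra.ι R N)
      map_add' := fun m n => by rw [map_add, gen_add] }
    (fun a m => (congrArg (gen R N) (map_smul f.hom a m)).trans (gen_smul R N a _))

theorem symMap_proj (f : M ⟶ N) : symMap f ≫ symProj R M = symProj R N := symHom_proj _ _ _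

theorem ev_symMap_gen (f : M ⟶ N) (m : M) : ev (symMap f) (gen R M m) = gen R N (f m) :=
  ev_symHom_gen _ _ _ m

theorem symMap_comp_symMap_eq_id {f : M ⟶ N} {g : N ⟶ M} (h : f ≫ g = 𝟙 M) :
    symMap g ≫ symMap f = 𝟙 (symE R M) := by
  refine hom_symE_ext ?_ fun m => ?_
  · rw [Category.assoc, symMap_proj, symMap_proj, Category.id_comp]
  · rw [ev_comp, ev_symMap_gen, ev_symMap_gen, ev_id]
    exact congrArg (fun k : M ⟶ M => gen R M (k m)) h

/-- `M ↦ Sym_R(M)` on isomorphisms. -/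
def symBundleIso (e : M ≅ N) : (symBundle R M).toDBun ≅ (symBundle R N).toDBun :=
  DBun.isoMk ⟨symMap e.inv, symMap e.hom, symMap_comp_symMap_eq_id e.hom_inv_id,
    symMap_comp_symMap_eq_id e.inv_hom_id⟩ (symMap_proj e.inv) <| by
    change symLift R M ≫ T.map (symMap e.inv) = symMap e.inv ≫ symLift R N
    refine hom_T_symE_ext ?_ (fun m => ?_) fun m => ?_
    · rw [Category.assoc, ← T.map_comp, symMap_proj, symLift_map_proj, Category.assoc,
        symLift_map_proj, ← Category.assoc, symMap_proj]
    · rw [Category.assoc, map_p, ← Category.assoc, symLift_p, Category.assoc, ev_comp, ev_comp,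
        ev_symMap_gen, ev_symZero_gen, map_zero, Category.assoc, symLift_p, ev_comp,
        ev_comp, ev_symZero_gen, map_zero, map_zero]
    · rw [der_comp_map, ev_symMap_gen, der_symLift_gen, der_comp, der_symLift_gen, ev_symMap_gen]

end SymMap

/-! ### The two constructions are mutually inverse -/

/-- The map `m ↦ m` from `M` to the image of `D_λ` on `Sym_R(M)`. -/
def symModuleMap (M : ModuleCat.{u} R) : M →ₗ[R] (symBundle R M).toModule where
  toFun m := (symBundle R M).toIm (gen R M m)
  map_add' m n := (congrArg _ (gen_add R M m n)).trans (Subtype.ext (map_add (der _) _ _))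
  map_smul' a m := Subtype.ext <| (der_symLift_gen R M _).trans <|
    (gen_smul R M a m).trans (congrArg _ (der_symLift_gen R M m).symm)

theorem symModuleMap_incl (M : ModuleCat.{u} R) (m : M) :
    (symBundle R M).incl (symModuleMap M m) = gen R M m :=
  der_symLift_gen R M m

/-- `M` is the module of elements of degree one of `Sym_R(M)`. -/
def symModuleEquiv (M : ModuleCat.{u} R) : M ≃ₗ[R] (symBundle R M).toModule :=
  LinearEquiv.ofBijective (symModuleMap M) <| by
    refine ⟨fun m n h => ι_injective R M ?_, fun m => ?_⟩
    · exact (symModuleMap_incl M m).symm.trans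
        ((congrArg (symBundle R M).incl h).trans (symModuleMap_incl M n))
    · obtain ⟨x, hx⟩ := DBun.exists_der_lam_eq m
      obtain ⟨n, hn⟩ := exists_gen_eq_der_symLift R M x
      exact ⟨n, Subtype.ext ((symModuleMap_incl M n).trans (hn.symm.trans hx))⟩

namespace DBun

variable (𝓔 : DBun R)

theorem psi_proj : 𝓔.psi ≫ symProj R 𝓔.toModule = 𝓔.q :=
  hom_ext_ev fun a => (SymmetricAlgebra.lift 𝓔.incl).commutes a

theorem ev_psi_gen (m : 𝓔.toModule) : ev 𝓔.psi (gen R _ m) = 𝓔.incl m :=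
  SymmetricAlgebra.lift_ι_apply 𝓔.incl m

theorem psi_lift : 𝓔.lam ≫ T.map 𝓔.psi = 𝓔.psi ≫ symLift R 𝓔.toModule := by
  refine hom_T_symE_ext ?_ (fun m => ?_) fun m => ?_
  · rw [Category.assoc, ← T.map_comp, psi_proj, 𝓔.isDifferentialBundle.lift_proj, Category.assoc,
      symLift_map_proj, ← Category.assoc, psi_proj]
  · obtain ⟨x, hx⟩ := exists_der_lam_eq m
    rw [Category.assoc, map_p, ← Category.assoc, 𝓔.isDifferentialBundle.lift_p, ev_comp _ 𝓔.psi,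
      ev_psi_gen, ← hx, ev_comp, 𝓔.isDifferentialBundle.ev_z_der_lam, map_zero, Category.assoc,
      symLift_p, ev_comp, ev_comp, ev_symZero_gen, map_zero, map_zero]
  · obtain ⟨x, hx⟩ := exists_der_lam_eq m
    rw [der_comp_map, ev_psi_gen, ← hx, 𝓔.isDifferentialBundle.der_lam_der_lam, der_comp,
      der_symLift_gen, ev_psi_gen, ← hx]

/-- The inverse of `ψ` is obtained from the derivation `D_λ : E → im(D_λ) ⊆ Sym_R(im(D_λ))`. -/
theorem exists_psi_inv : ∃ w : symE R 𝓔.toModule ⟶ 𝓔.E, 𝓔.psi ≫ w = 𝟙 _ ∧ w ≫ 𝓔.psi = 𝟙 _ := by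
  have h := 𝓔.isDifferentialBundle
  obtain ⟨w, hw, hw'⟩ := h.exists_ev_der_lam (symProj R 𝓔.toModule)
    { toFun := fun x => gen R _ (𝓔.toIm x)
      map_zero' := by
        rw [show 𝓔.toIm 0 = 0 from Subtype.ext (map_zero (der 𝓔.lam))]
        exact map_zero (SymmetricAlgebra.ι R 𝓔.toModule)
      map_add' := fun x y => by
        rw [show 𝓔.toIm (x + y) = 𝓔.toIm x + 𝓔.toIm y from
          Subtype.ext (map_add (der 𝓔.lam) x y), gen_add] }
    (fun x y => by
      have hxy : 𝓔.toIm (x * y) =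
          (ev 𝓔.z x : R) • 𝓔.toIm y + (ev 𝓔.z y : R) • 𝓔.toIm x :=
        Subtype.ext (h.der_lam_mul x y)
      change gen R _ (𝓔.toIm (x * y)) = _ * gen R _ (𝓔.toIm y) + _ * gen R _ (𝓔.toIm x)
      rw [hxy, gen_add, gen_smul, gen_smul, ev_comp, ev_comp])
    (fun a => by
      change gen R _ (𝓔.toIm (ev 𝓔.q a)) = 0
      rw [show 𝓔.toIm (ev 𝓔.q a) = 0 from Subtype.ext (h.der_lam_q a)]
      exact map_zero (SymmetricAlgebra.ι R 𝓔.toModule))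
  have hw'' (x : 𝓔.E.unop) : ev w (der 𝓔.lam x) = gen R _ (𝓔.toIm x) := hw' x
  refine ⟨w, h.hom_ext_der_lam ?_ fun x => ?_, hom_symE_ext ?_ fun m => ?_⟩
  · rw [Category.assoc, hw, psi_proj, Category.id_comp]
  · rw [ev_comp, hw'', ev_psi_gen, ev_id]
    rfl
  · rw [Category.assoc, psi_proj, hw, Category.id_comp]
  · obtain ⟨x, hx⟩ := exists_der_lam_eq m
    rw [ev_comp, ev_psi_gen, ← hx, hw'', ev_id]
    exact congrArg _ (Subtype.ext hx)

/-- `ψ` as an isomorphism of differential bundles between `𝓔` and `Sym_R(im(D_λ))`. -/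
def psiIso : 𝓔 ≅ (symBundle R 𝓔.toModule).toDBun :=
  isoMk (𝓕 := (symBundle R 𝓔.toModule).toDBun)
    ⟨𝓔.psi, 𝓔.exists_psi_inv.choose, 𝓔.exists_psi_inv.choose_spec.1,
      𝓔.exists_psi_inv.choose_spec.2⟩ 𝓔.psi_proj 𝓔.psi_lift

end DBun

variable (R)

/-- Isomorphism classes of `R`-modules and of differential bundles over `R`. -/
def isoClassesEquiv : IsoClasses (ModuleCat.{u} R) ≃ IsoClasses (DBun R) where
  toFun := Quotient.map (fun M => (symBundle R M).toDBun) fun _ _ ⟨e⟩ => ⟨symBundleIso e⟩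
  invFun := Quotient.map (fun 𝓔 => 𝓔.toModule) fun _ _ ⟨e⟩ => ⟨DBun.toModuleIso e⟩
  left_inv c := by
    induction c using Quotient.inductionOn with
    | h M => exact Quotient.sound ⟨(symModuleEquiv M).toModuleIso.symm⟩
  right_inv c := by
    induction c using Quotient.inductionOn with
    | h 𝓔 => exact Quotient.sound ⟨𝓔.psiIso.symm⟩

/-- Isomorphism classes of `R`-modules and of differential bundles with negatives over `R`. -/
def isoClassesEquivNeg : IsoClasses (ModuleCat.{u} R) ≃ IsoClasses (DBunNeg R) where
  toFun := Quotient.map (fun M => symBundle R M) fun _ _ ⟨e⟩ =>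
    ⟨DBunNeg.isoEquiv _ _ (symBundleIso e)⟩
  invFun := Quotient.map (fun 𝓔 => 𝓔.toModule) fun _ _ ⟨e⟩ =>
    ⟨DBun.toModuleIso ((DBunNeg.isoEquiv _ _).symm e)⟩
  left_inv c := by
    induction c using Quotient.inductionOn with
    | h M => exact Quotient.sound ⟨(symModuleEquiv M).toModuleIso.symm⟩
  right_inv c := by
    induction c using Quotient.inductionOn with
    | h 𝓔 => exact Quotient.sound ⟨DBunNeg.isoEquiv _ _ 𝓔.psiIso.symm⟩

end AffTangent
end

theorem mainTheorem3 (R : CommRingCat.{u}) :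
    ∃ (hM : ∀ M : ModuleCat.{u} R, (symData R M).IsDifferentialBundle)
      (hN : ∀ M : ModuleCat.{u} R, (symData R M).IsNegative (symNeg R M)),
      -- the module recovered from `Sym_R(M)` is `M`, via `m ↦ m`
      (∀ M : ModuleCat.{u} R, ∃ α : M ≅ (symBun R M (hM M) (hN M)).toModule,
        ∀ m : M, (symBun R M (hM M) (hN M)).incl (α.hom.hom m) = SymmetricAlgebra.ι R M m) ∧
      -- the bundle recovered from `im(D_λ)` is the given one, via `ψ`
      (∀ 𝓔 : DBun R, ∃ ψ : 𝓔 ≅ (symBun R 𝓔.toModule (hM _) (hN _)).toDBun,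
        ψ.hom.hom = 𝓔.psi) ∧
      (∀ 𝓔 : DBunNeg R, ∃ ψ : 𝓔 ≅ symBun R 𝓔.toModule (hM _) (hN _),
        DBun.Hom.hom ψ.hom = 𝓔.psi) ∧
      -- every differential bundle over `R` has exactly one negative
      (∀ 𝓔 : DBun R, ∃! ι : 𝓔.E ⟶ 𝓔.E, 𝓔.IsNegative ι) ∧
      -- the bijection with differential bundles
      (∃ Φ : IsoClasses (ModuleCat.{u} R) ≃ IsoClasses (DBun R),
        (∀ M, Φ (isoClass M) = isoClass (symBun R M (hM M) (hN M)).toDBun) ∧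
        (∀ 𝓔, Φ.symm (isoClass 𝓔) = isoClass 𝓔.toModule)) ∧
      -- the bijection with differential bundles with negatives
      (∃ Φ : IsoClasses (ModuleCat.{u} R) ≃ IsoClasses (DBunNeg R),
        (∀ M, Φ (isoClass M) = isoClass (symBun R M (hM M) (hN M))) ∧
        (∀ 𝓔, Φ.symm (isoClass 𝓔) = isoClass 𝓔.toModule)) := by
  exact ⟨symData_isDifferentialBundle R, symData_isNegative R,
    fun M => ⟨(symModuleEquiv M).toModuleIso, symModuleMap_incl M⟩,
    fun 𝓔 => ⟨𝓔.psiIso, rfl⟩,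
    fun 𝓔 => ⟨DBunNeg.isoEquiv _ _ 𝓔.psiIso, rfl⟩,
    fun 𝓔 => 𝓔.isDifferentialBundle.existsUnique_isNegative,
    ⟨isoClassesEquiv R, fun _ => rfl, fun _ => rfl⟩,
    ⟨isoClassesEquivNeg R, fun _ => rfl, fun _ => rfl⟩⟩
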